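/- Let $Q$ be an $n$-dimensional smooth manifold (Hausdorff, second countable, connected), with natural coordinates $(q^\mu,v^\mu,t)$ on $TQ\times\mathbb{R}$, and let $L\in C^\infty(TQ\times\mathbb{R})$ be a time-dependent Lagrangian which is regular, i.e. $\det\big(\partial^2L/\partial v^\mu\partial v^\nu\big)\neq 0$ at every point. Let $$\Theta_L = dL\circ\mathcal{V}+L\,dt,\qquad \Omega_L=-d\Theta_L,\qquad \mathcal{V}=(dq^\mu-v^\mu dt)\otimes\frac{\partial}{\partial v^\mu},$$ be its Poincaré–Cartan forms. Let $\nabla$ be a connection on $Q\times\mathbb{R}\to\mathbb{R}$, given by a smooth time-dependent vector field $Y=\Gamma^\mu(q,t)\,\partial/\partial q^\mu$ on $Q$; let $\widetilde Y=\partial/\partial t+Y$ and let $$j^1\widetilde Y=\frac{\partial}{\partial t}+\Gamma^\mu\frac{\partial}{\partial q^\mu}+\Big(\frac{\partial\Gamma^\mu}{\partial t}+v^\nu\frac{\partial\Gamma^\mu}{\partial q^\nu}\Big)\frac{\partial}{\partial v^\mu}$$ be its canonical lift to $TQ\times\mathbb{R}$. Put $$\Omega_L^V=\Omega_L-dt\wedge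 i(j^1\widetilde Y)\Omega_L,\qquad E_L^\nabla=-i(j^1\widetilde Y)\Theta_L .$$ Assume that $j^1\widetilde Y$ is complete and is an infinitesimal symmetry of $L$, i.e. $\mathcal{L}(j^1\widetilde Y)L=0$. Let $[TQ\times\mathbb{R}]=(TQ\times\mathbb{R})/j^1\widetilde Y$ be the space of orbits of $j^1\widetilde Y$ with the quotient topology, $\bar\pi^1\colon TQ\times\mathbb{R}\to[TQ\times\mathbb{R}]$ the projection, and assume that $[TQ\times\mathbb{R}]$ carries a smooth manifold structure for which $\bar\pi^1$ is a submersion. Then there are a unique $2$-form $\omega$ and a unique function $\mathcal{E}$ on $[TQ\times\mathbb{R}]$ with $(\bar\pi^1)^*\omega=\Omega_L^V$ and $(\bar\pi^1)^*\mathcal{E}=E_L^\nabla$, and: 1. $\omega$ is smooth, closed and non-degenerate, so $([TQ\times\mathbb{R}],\omega)$ is a symplectic manifold; 2. $\mathcal{E}$ is smooth, so $([TQ\times\mathbb{R}],\omega,\mathcal{E})$ is a Hamiltonian system: there is a unique vector field $\mathcal{X}$ on $[TQ\times\mathbb{R}]$ with $i(\mathcal{X})\omega=d\mathcal{E}$,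 and it is smooth. It is the reduced dynamics: every vector field $X_L$ on $TQ\times\mathbb{R}$ with $i(X_L)\Omega_L=0$ and $i(X_L)dt=1$ satisfies $T\bar\pi^1\circ X_L=\mathcal{X}\circ\bar\pi^1$. -/

import Mathlib

open scoped Manifold ContDiff Topology

noncomputable section

/-! ### Differential forms on manifolds -/

namespace DiffForm

variable {E : Type*} [NormedAddCommGroup E] [NormedSpace ℝ E]
  {H : Type*} [TopologicalSpace H] (I : ModelWithCorners ℝ E H)
  (M : Type*) [TopologicalSpace M] [ChartedSpace H M]
  {E' : Type*} [NormedAddCommGroup E'] [NormedSpace ℝ E']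
  {H' : Type*} [TopologicalSpace H'] (I' : ModelWithCorners ℝ E' H')
  {M' : Type*} [TopologicalSpace M'] [ChartedSpace H' M']

/-- A (not necessarily smooth) field of alternating `k`-forms on the manifold `M`. -/
abbrev Form (k : ℕ) : Type _ := ∀ x : M, TangentSpace I x [⋀^Fin k]→L[ℝ] ℝ

/-- A (not necessarily smooth) field of covectors on the manifold `M`. -/
abbrev Covector : Type _ := ∀ x : M, TangentSpace I x →L[ℝ] ℝ

/-- A (not necessarily smooth) vector field on the manifold `M`. -/
abbrev VField : Type _ := ∀ x : M, TangentSpace I x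

variable {M}

/-- A covector field regarded as a `1`-form. -/
def Covector.toForm (α : Covector I M) : Form I M 1 :=
  fun x => ContinuousAlternatingMap.ofSubsingleton ℝ (TangentSpace I x) ℝ (0 : Fin 1) (α x)

/-- The pullback `(φ⁻¹)^* η` of the form `η` by the inverse of the chart `φ` at `x₀`: a form on
the model vector space, meaningful on the target of the chart. -/
def inChart {k : ℕ} (η : Form I M k) (x₀ : M) : E → E [⋀^Fin k]→L[ℝ] ℝ :=
  fun y => (η ((extChartAt I x₀).symm y)).compContinuousLinearMap
    (mfderivWithin 𝓘(ℝ, E) I (extChartAt I x₀).symm (Set.range I) y)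

/-- A form is smooth if its coefficients are smooth in every chart. -/
def IsSmooth {k : ℕ} (η : Form I M k) : Prop :=
  ∀ x₀ : M, ContDiffOn ℝ ∞ (inChart I η x₀) (extChartAt I x₀).target

/-- The exterior derivative `d η`; at the point `x` it is `φ^* (d ((φ⁻¹)^* η))`, where `φ` is the
chart at `x`. -/
def d {k : ℕ} (η : Form I M k) : Form I M (k + 1) :=
  fun x => (extDerivWithin (inChart I η x) (Set.range I)
    (extChartAt I x x)).compContinuousLinearMap (mfderiv I 𝓘(ℝ, E) (extChartAt I x) x)

/-- The wedge product of two covectors: `(α ∧ β)(u, v) = α(u) β(v) - α(v) β(u)`,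
see `DiffForm.wedge_apply`. -/
def wedge {x : M} (α β : TangentSpace I x →L[ℝ] ℝ) : TangentSpace I x [⋀^Fin 2]→L[ℝ] ℝ :=
  ContinuousMultilinearMap.alternatization
    ((ContinuousMultilinearMap.mkPiAlgebra ℝ (Fin 2) ℝ).compContinuousLinearMap ![α, β])

theorem wedge_apply {x : M} (α β : TangentSpace I x →L[ℝ] ℝ) (u v : TangentSpace I x) :
    wedge I α β ![u, v] = α u * β v - α v * β u := by
  have h : (Finset.univ : Finset (Equiv.Perm (Fin 2))) = {1, Equiv.swap 0 1} := by decide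
  rw [wedge, ContinuousMultilinearMap.alternatization_apply_apply, h,
    Finset.sum_pair (by decide)]
  simp [Fin.prod_univ_two]
  ring

/-- The interior product `i(X) η = η(X, ·)` of a tangent vector and a `2`-form at a point,
see `DiffForm.interiorProduct_apply`. -/
def interiorProduct {x : M} (X : TangentSpace I x) (η : TangentSpace I x [⋀^Fin 2]→L[ℝ] ℝ) :
    TangentSpace I x →L[ℝ] ℝ :=
  η.toContinuousMultilinearMap.toContinuousLinearMap ![X, 0] 1

theorem interiorProduct_apply {x : M} (X : TangentSpace I x) (η : TangentSpace I x [⋀^Fin 2]→L[ℝ] ℝ)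
    (v : TangentSpace I x) : interiorProduct I X η v = η ![X, v] := by
  simp [interiorProduct, ContinuousMultilinearMap.toContinuousLinearMap]
  congr 1
  ext i
  fin_cases i <;> simp

/-- The pullback `f^* η` of a form. -/
def pullback {k : ℕ} (f : M → M') (η : Form I' M' k) : Form I M k :=
  fun x => (η (f x)).compContinuousLinearMap (mfderiv I I' f x)

/-- A symplectic form: a smooth, closed and non-degenerate `2`-form. -/
structure IsSymplectic (η : Form I M 2) : Prop where
  smooth : IsSmooth I η
  closed : d I η = 0
  nondegenerate : ∀ (x : M) (X : TangentSpace I x), interiorProduct I X (η x) = 0 → X = 0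

end DiffForm

/-! ### Time-dependent Lagrangian systems -/

namespace TimeDependent

open DiffForm

variable (n : ℕ) (Q : Type*) [TopologicalSpace Q] [ChartedSpace (EuclideanSpace ℝ (Fin n)) Q]
  [IsManifold (𝓡 n) ∞ Q]

/-- The phase space `TQ × ℝ`, the first jet bundle of `Q × ℝ → ℝ`. -/
abbrev Phase : Type _ := TangentBundle (𝓡 n) Q × ℝ

/-- The model with corners of the manifold `TQ × ℝ`. -/
abbrev phaseModel := (𝓡 n).tangent.prod 𝓘(ℝ, ℝ)

/-- A connection on `Q × ℝ → ℝ`, given by its associated time-dependent vector field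
`Y (q, t) ∈ T_q Q`; the corresponding section of `TQ × ℝ → Q × ℝ` is `(q, t) ↦ (Y (q, t), t)`. -/
structure Connection where
  /-- the time-dependent vector field -/
  Y : ∀ p : Q × ℝ, TangentSpace (𝓡 n) p.1
  smooth : ContMDiff ((𝓡 n).prod 𝓘(ℝ, ℝ)) (𝓡 n).tangent ∞
    (fun p : Q × ℝ => (⟨p.1, Y p⟩ : TangentBundle (𝓡 n) Q))

variable {n Q}

/-- The `1`-form `dt` on `TQ × ℝ`. -/
def dt : Covector (phaseModel n) (Phase n Q) :=
  fun p => mfderiv (phaseModel n) 𝓘(ℝ, ℝ) (fun p' : Phase n Q => p'.2) p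

/-- The structure canonical form `ϑ = (dq^μ - v^μ dt) ⊗ ∂/∂q^μ` of `TQ × ℝ`,
at the point `(v_q, t)` a linear map to `T_q Q`. -/
def structureForm (p : Phase n Q) :
    TangentSpace (phaseModel n) p →L[ℝ] TangentSpace (𝓡 n) p.1.proj :=
  mfderiv (phaseModel n) (𝓡 n) (fun p' : Phase n Q => p'.1.proj) p -
    (dt p).smulRight p.1.snd

/-- The vertical lift `T_q Q → T_{(v_q, t)} (TQ × ℝ)`, `∂/∂q^μ ↦ ∂/∂v^μ`: the differential at
`v_q` of the inclusion of the fibre `T_q Q × {t}`. -/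
def verticalLift (p : Phase n Q) :
    TangentSpace (𝓡 n) p.1.proj →L[ℝ] TangentSpace (phaseModel n) p :=
  mfderiv 𝓘(ℝ, EuclideanSpace ℝ (Fin n)) (phaseModel n)
    (fun u : EuclideanSpace ℝ (Fin n) =>
      ((⟨p.1.proj, u⟩, p.2) : Phase n Q)) p.1.snd

/-- The vertical endomorphism `𝒱 = (dq^μ - v^μ dt) ⊗ ∂/∂v^μ` of `TQ × ℝ`. -/
def verticalEndo (p : Phase n Q) :
    TangentSpace (phaseModel n) p →L[ℝ] TangentSpace (phaseModel n) p :=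
  (verticalLift p).comp (structureForm p)

/-- The differential of a function on `TQ × ℝ`. -/
def dFun (f : Phase n Q → ℝ) : Covector (phaseModel n) (Phase n Q) :=
  fun p => mfderiv (phaseModel n) 𝓘(ℝ, ℝ) f p

/-- The Poincaré-Cartan `1`-form `Θ_L = dL ∘ 𝒱 + L dt`. -/
def cartanOne (L : Phase n Q → ℝ) : Covector (phaseModel n) (Phase n Q) :=
  fun p => (dFun L p).comp (verticalEndo p) + L p • dt p

/-- The Poincaré-Cartan `2`-form `Ω_L = -dΘ_L`. -/
def cartanTwo (L : Phase n Q → ℝ) : Form (phaseModel n) (Phase n Q) 2 :=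
  -d (phaseModel n) (Covector.toForm (phaseModel n) (cartanOne L))

/-- The Hessian matrix `∂²L/∂v^μ∂v^ν` of the restriction of `L` to the fibre `T_q Q × {t}`, at the
point `(v_q, t)`. -/
def fibreHessian (L : Phase n Q → ℝ) (p : Phase n Q) : Matrix (Fin n) (Fin n) ℝ :=
  Matrix.of fun μ ν =>
    iteratedFDeriv ℝ 2
      (fun u : EuclideanSpace ℝ (Fin n) => L (⟨p.1.proj, u⟩, p.2)) p.1.snd
      ![EuclideanSpace.single μ 1, EuclideanSpace.single ν 1]

/-- A Lagrangian is regular if `det (∂²L/∂v^μ∂v^ν)` is different from zero at every point. -/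
def IsRegular (L : Phase n Q → ℝ) : Prop :=
  ∀ p, (fibreHessian L p).det ≠ 0

namespace Connection

variable (C : Connection n Q)

/-- The time-dependent vector field as a map `Q × ℝ → TQ`. -/
def lift (p : Q × ℝ) : TangentBundle (𝓡 n) Q := ⟨p.1, C.Y p⟩

/-- The suspension `Ỹ = ∂/∂t + Y`, a vector field on `Q × ℝ`. -/
def suspension : VField ((𝓡 n).prod 𝓘(ℝ, ℝ)) (Q × ℝ) := fun p => (C.Y p, (1 : ℝ))

/-- The canonical lift (first jet prolongation) `j¹Ỹ` of the suspension `Ỹ` to `TQ × ℝ`, in natural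
coordinates `∂/∂t + Γ^μ ∂/∂q^μ + (∂Γ^μ/∂t + v^ν ∂Γ^μ/∂q^ν) ∂/∂v^μ`.

A tangent vector of `TQ × ℝ` at `(v_q, t)` is the triple of its components `((δq, δv), δt)` in the
chart induced by the chart of `Q` at `q`. The differential of `Y : Q × ℝ → TQ` at `(q, t)` sends
`(v, 1)` to the vector with components `(v, ∂Γ/∂t + v^ν ∂Γ/∂q^ν)` in the same chart, so that the
`TQ`-part below is the canonical flip of `TTQ` applied to `TY (v, 1)`. -/
def jetLift : VField (phaseModel n) (Phase n Q) := fun p =>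
  let A : EuclideanSpace ℝ (Fin n) × EuclideanSpace ℝ (Fin n) :=
    mfderiv ((𝓡 n).prod 𝓘(ℝ, ℝ)) (𝓡 n).tangent C.lift (p.1.proj, p.2)
      ((p.1.snd, (1 : ℝ)) : TangentSpace (𝓡 n) p.1.proj × ℝ)
  let Z : EuclideanSpace ℝ (Fin n) × ℝ := C.suspension (p.1.proj, p.2)
  (((Z.1, A.2), Z.2) : (EuclideanSpace ℝ (Fin n) × EuclideanSpace ℝ (Fin n)) × ℝ)

/-- `j¹Ỹ` is complete: through every point there is an integral curve defined on all of `ℝ`. -/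
def IsComplete : Prop :=
  ∀ p : Phase n Q, ∃ γ : ℝ → Phase n Q, γ 0 = p ∧ IsMIntegralCurve (I := phaseModel n) γ C.jetLift

/-- `j¹Ỹ` is an infinitesimal symmetry of `L`: the Lie derivative of `L` along it vanishes. -/
def IsSymmetry (L : Phase n Q → ℝ) : Prop :=
  ∀ p, dFun L p (C.jetLift p) = 0

/-- Two points are in the same orbit of `j¹Ỹ` if an integral curve passes through both. -/
def SameOrbit (p p' : Phase n Q) : Prop :=
  ∃ γ : ℝ → Phase n Q, IsMIntegralCurve (I := phaseModel n) γ C.jetLift ∧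
    ∃ s s' : ℝ, γ s = p ∧ γ s' = p'

/-- The quotient `[TQ × ℝ] = (TQ × ℝ) / j¹Ỹ`, with the quotient topology. -/
abbrev Reduced : Type _ := Quot C.SameOrbit

/-- The natural projection `TQ × ℝ → [TQ × ℝ]`. -/
abbrev proj : Phase n Q → C.Reduced := Quot.mk C.SameOrbit

/-- The vertical part `Ω_L^V = Ω_L - dt ∧ i(j¹Ỹ) Ω_L` of the Poincaré-Cartan `2`-form. -/
def cartanVert (L : Phase n Q → ℝ) : Form (phaseModel n) (Phase n Q) 2 := fun p =>
  cartanTwo L p - wedge (phaseModel n) (dt p)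
    (interiorProduct (phaseModel n) (C.jetLift p) (cartanTwo L p))

/-- The Lagrangian energy `E_L^∇ = -i(j¹Ỹ) Θ_L`. -/
def energy (L : Phase n Q → ℝ) : Phase n Q → ℝ := fun p => -cartanOne L p (C.jetLift p)

end Connection

end TimeDependent

end

/-!
Write `j` for the canonical lift `j¹Ỹ`, `Θ`, `Ω = -dΘ` for the Poincaré-Cartan forms of `L` and
`E = -Θ(j)` for the energy. The symmetry `j(L) = 0` gives `i(j)Ω = -dE`; this is a computation
in natural coordinates (`Coord.fderiv_cartan_jet`), globalized in `cartanTwo_jetLift`. It has two consequences. First, `dE(j) = -Ω(j, j) = 0`, so `E` is constant on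
the orbits of `j` and descends to a function `ℰ`. Secondly, `Ω^V = Ω + dt ∧ dE` is exact, with
potential `α = -(Θ + E dt)` (`cartanVert_eq`), and both `α` and `dα = Ω^V` vanish on `j`.

By completeness and the uniqueness of integral curves, the fibres of the projection are exactly the
integral curves of `j`, and the time coordinate parametrizes them. They are therefore connected, and
the kernel of the differential of the projection is spanned by `j` (`eq_smul_jetLift`): a vector in
the kernel is the velocity of a curve in a fibre, which is a reparametrization of an integral curve.
A `1`-form that vanishes on the kernel together with its exterior derivative is, in a submersion
chart, locally constant along the fibres; when these are connected, it descends
(`exists_pullback_eq`). So `α` is the pullback of a smooth `1`-form `θ`, and `η = dθ` is smooth,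
closed and pulls back to `Ω^V`; it is the only form that does, because the differential of a
submersion is surjective.

If `i(X)η = 0`, lift `X` to a vector `w`. As `j` projects to zero and `dt(j) = 1`, it can be arranged
that `dt(w) = 0`. Then `Ω(w, u) = 0` whenever `dt(u) = 0`, and regularity of `L` forces `w = 0`
(`eq_zero_of_cartanTwo`). Hence `η` is symplectic and `ℰ` has a unique Hamiltonian vector field
(`IsSymplectic.exists_hamiltonian`). Finally, if `i(X_L)Ω = 0` and `dt(X_L) = 1`, then
`i(X_L)Ω^V = dE`, so the projection of `X_L` is a Hamiltonian vector for `ℰ` at each point, and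
uniqueness identifies it with the reduced dynamics.
-/

noncomputable section

/-! ### Smoothness of the pullback of alternating maps -/

namespace ContinuousAlternatingMap

variable {E F G : Type*} [NormedAddCommGroup E] [NormedSpace ℝ E]
  [NormedAddCommGroup F] [NormedSpace ℝ F] [NormedAddCommGroup G] [NormedSpace ℝ G]

/-- Alternatization, divided by `k!`, as a continuous linear map: it is a retraction of the
inclusion of the alternating maps into the multilinear maps. It transfers smoothness of operations
on multilinear maps to alternating maps. -/
def retraction (E) [NormedAddCommGroup E] [NormedSpace ℝ E] (k : ℕ) :
    ContinuousMultilinearMap ℝ (fun _ : Fin k => E) ℝ →L[ℝ] E [⋀^Fin k]→L[ℝ] ℝ :=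
  (k.factorial : ℝ)⁻¹ • LinearMap.mkContinuous
    { toFun := fun f => ContinuousMultilinearMap.alternatization f
      map_add' := fun f g => map_add _ f g
      map_smul' := fun c f => by
        ext v
        simp [ContinuousMultilinearMap.alternatization_apply_apply, Finset.mul_sum,
          mul_smul_comm] }
    (k.factorial : ℝ) (fun f => by
      refine ContinuousAlternatingMap.opNorm_le_bound _ (by positivity) fun v => ?_
      simp only [LinearMap.coe_mk, AddHom.coe_mk,
        ContinuousMultilinearMap.alternatization_apply_apply]
      refine (norm_sum_le _ _).trans ?_
      have h : ∀ σ : Equiv.Perm (Fin k),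
          ‖Equiv.Perm.sign σ • f (v ∘ σ)‖ ≤ ‖f‖ * ∏ i, ‖v i‖ := by
        intro σ
        have h1 : ‖Equiv.Perm.sign σ • f (v ∘ σ)‖ = ‖f (v ∘ σ)‖ := by
          rcases Int.units_eq_one_or (Equiv.Perm.sign σ) with h | h <;> simp [h]
        rw [h1]
        refine (f.le_opNorm _).trans_eq ?_
        congr 1
        exact Equiv.prod_comp σ (fun i => ‖v i‖)
      refine (Finset.sum_le_sum fun σ _ => h σ).trans_eq ?_
      simp [Fintype.card_perm, mul_assoc])

theorem retraction_apply {k : ℕ} (η : E [⋀^Fin k]→L[ℝ] ℝ) :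
    retraction E k η.toContinuousMultilinearMap = η := by
  ext v
  change (k.factorial : ℝ)⁻¹ •
    ContinuousMultilinearMap.alternatization η.toContinuousMultilinearMap v = η v
  rw [ContinuousMultilinearMap.alternatization_apply_apply]
  have h : ∀ σ : Equiv.Perm (Fin k),
      Equiv.Perm.sign σ • η.toContinuousMultilinearMap (v ∘ σ) = η v := by
    intro σ
    have := η.toAlternatingMap.map_perm v σ
    change Equiv.Perm.sign σ • η.toAlternatingMap (v ∘ σ) = _
    rw [this, smul_smul, Int.units_mul_self, one_smul]
    rfl
  rw [Finset.sum_congr rfl fun σ _ => h σ]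
  simp [Fintype.card_perm, Nat.factorial_ne_zero]

theorem _root_.ContDiffAt.continuousAlternatingMap_compContinuousLinearMap
    {k : ℕ} {r : ℕ∞ω} {η : G → F [⋀^Fin k]→L[ℝ] ℝ} {g : G → E →L[ℝ] F} {x : G}
    (hη : ContDiffAt ℝ r η x) (hg : ContDiffAt ℝ r g x) :
    ContDiffAt ℝ r (fun y => (η y).compContinuousLinearMap (g y)) x := by
  have h : (fun y => (η y).compContinuousLinearMap (g y)) = fun y =>
      retraction E k (ContinuousMultilinearMap.compContinuousLinearMapContinuousMultilinear ℝ
        (fun _ : Fin k => E) (fun _ : Fin k => F) ℝ (fun _ => g y)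
        (toContinuousMultilinearMapCLM ℝ (η y))) := by
    funext y
    exact (retraction_apply ((η y).compContinuousLinearMap (g y))).symm
  rw [h]
  refine (retraction E k).contDiff.contDiffAt.comp x ?_
  refine ContDiffAt.clm_apply ?_ ?_
  · exact (ContinuousMultilinearMap.contDiff _).contDiffAt.comp x (contDiffAt_pi.2 fun _ => hg)
  · exact (toContinuousMultilinearMapCLM ℝ).contDiff.contDiffAt.comp x hη

end ContinuousAlternatingMap

/-! ### Pullback and exterior derivative of forms on manifolds -/

namespace DiffForm

variable {E : Type*} [NormedAddCommGroup E] [NormedSpace ℝ E]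
  {H : Type*} [TopologicalSpace H] {I : ModelWithCorners ℝ E H}
  {M : Type*} [TopologicalSpace M] [ChartedSpace H M]
  {E' : Type*} [NormedAddCommGroup E'] [NormedSpace ℝ E']
  {H' : Type*} [TopologicalSpace H'] {I' : ModelWithCorners ℝ E' H'}
  {N : Type*} [TopologicalSpace N] [ChartedSpace H' N]
  {G : Type*} [NormedAddCommGroup G] [NormedSpace ℝ G]

section

variable {k : ℕ}

/-- The pullback of a form on `M` along a map `ξ` from a normed space, as a form on that space. -/
def pullbackModel (I : ModelWithCorners ℝ E H) (ξ : G → M) (η : Form I M k) (y : G) :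
    G [⋀^Fin k]→L[ℝ] ℝ :=
  (η (ξ y)).compContinuousLinearMap (mfderiv 𝓘(ℝ, G) I ξ y)

theorem pullbackModel_congr {ξ ξ' : G → M} {y : G} (h : ξ =ᶠ[𝓝 y] ξ') (η : Form I M k) :
    pullbackModel I ξ η y = pullbackModel I ξ' η y := by
  have h0 : ξ y = ξ' y := h.self_of_nhds
  have h1 : (mfderiv 𝓘(ℝ, G) I ξ y : G →L[ℝ] E) = mfderiv 𝓘(ℝ, G) I ξ' y := h.mfderiv_eq
  have h2 : ∀ (a b : M) (A B : G →L[ℝ] E), a = b → A = B →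
      ContinuousAlternatingMap.compContinuousLinearMap
        (show E [⋀^Fin k]→L[ℝ] ℝ from η a) A =
      ContinuousAlternatingMap.compContinuousLinearMap
        (show E [⋀^Fin k]→L[ℝ] ℝ from η b) B := by
    rintro a b A B rfl rfl
    rfl
  exact h2 _ _ _ _ h0 h1

theorem pullbackModel_comp {G' : Type*} [NormedAddCommGroup G'] [NormedSpace ℝ G']
    {ξ : G → M} {g : G' → G} {y : G'}
    (hξ : MDifferentiableAt 𝓘(ℝ, G) I ξ (g y)) (hg : DifferentiableAt ℝ g y) (η : Form I M k) :
    pullbackModel I (ξ ∘ g) η y =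
      (pullbackModel I ξ η (g y)).compContinuousLinearMap (fderiv ℝ g y) := by
  have h := mfderiv_comp y hξ hg.mdifferentiableAt
  rw [mfderiv_eq_fderiv] at h
  rw [pullbackModel, h]
  rfl

theorem pullbackModel_pullback {ξ : G → M} {f : M → N} {y : G}
    (hf : MDifferentiableAt I I' f (ξ y)) (hξ : MDifferentiableAt 𝓘(ℝ, G) I ξ y)
    (η : Form I' N k) :
    pullbackModel I ξ (pullback I I' f η) y = pullbackModel I' (f ∘ ξ) η y := by
  have h := mfderiv_comp y hf hξ
  rw [pullbackModel, pullbackModel, h]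
  rfl

theorem minSmoothness_two_le : minSmoothness ℝ 2 ≤ (∞ : ℕ∞ω) := by
  rw [minSmoothness_of_isRCLikeNormedField]
  exact WithTop.coe_le_coe.2 le_top

variable [I.Boundaryless]

theorem inChart_eq_pullbackModel (η : Form I M k) (x₀ : M) :
    inChart I η x₀ = pullbackModel I (extChartAt I x₀).symm η := by
  funext y
  rw [inChart, pullbackModel, I.range_eq_univ, mfderivWithin_univ]

theorem IsSmooth.contDiffAt {η : Form I M k} (hη : IsSmooth I η) {x₀ : M} {y : E}
    (hy : y ∈ (extChartAt I x₀).target) : ContDiffAt ℝ ∞ (inChart I η x₀) y :=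
  (hη x₀).contDiffAt ((isOpen_extChartAt_target x₀).mem_nhds hy)

theorem isSmooth_iff {η : Form I M k} : IsSmooth I η ↔
    ∀ (x₀ : M), ∀ y ∈ (extChartAt I x₀).target, ContDiffAt ℝ ∞ (inChart I η x₀) y :=
  ⟨fun h _ _ hy => h.contDiffAt hy, fun h x₀ y hy => (h x₀ y hy).contDiffWithinAt⟩

variable [IsManifold I ∞ M]

theorem contMDiffAt_extChartAt_symm {x₀ : M} {y : E} (hy : y ∈ (extChartAt I x₀).target) :
    ContMDiffAt 𝓘(ℝ, E) I ∞ (extChartAt I x₀).symm y :=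
  (contMDiffOn_extChartAt_symm x₀).contMDiffAt ((isOpen_extChartAt_target x₀).mem_nhds hy)

/-- In the chart at `x₀`, the pullback along `ξ` becomes the pullback of the chart expression. -/
theorem pullbackModel_eventuallyEq_chart {ξ : G → M} {y : G} (hξ : ContMDiffAt 𝓘(ℝ, G) I ∞ ξ y)
    (η : Form I M k) : pullbackModel I ξ η =ᶠ[𝓝 y] fun z =>
      (inChart I η (ξ y) (extChartAt I (ξ y) (ξ z))).compContinuousLinearMap
        (fderiv ℝ (extChartAt I (ξ y) ∘ ξ) z) := by
  set φ := extChartAt I (ξ y)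
  have hsrc : ∀ᶠ z in 𝓝 y, ξ z ∈ φ.source :=
    hξ.continuousAt.eventually ((isOpen_extChartAt_source (ξ y)).mem_nhds
      (mem_extChartAt_source (ξ y)))
  have hdiff : ∀ᶠ z in 𝓝 y, ContMDiffAt 𝓘(ℝ, G) I 1 ξ z :=
    (contMDiffAt_iff_contMDiffAt_nhds (by simp)).1 (hξ.of_le (by simp))
  filter_upwards [hsrc.eventually_nhds, hdiff] with z hz hdz
  have hz0 : ξ z ∈ φ.source := hz.self_of_nhds
  have heq : ξ =ᶠ[𝓝 z] φ.symm ∘ (φ ∘ ξ) := by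
    filter_upwards [hz] with w hw
    exact (φ.left_inv hw).symm
  have hφ : ContMDiffAt I 𝓘(ℝ, E) ∞ φ (ξ z) :=
    contMDiffAt_extChartAt' (by rwa [← extChartAt_source (I := I)])
  have hg : ContMDiffAt 𝓘(ℝ, G) 𝓘(ℝ, E) 1 (φ ∘ ξ) z := (hφ.of_le (by simp)).comp z hdz
  rw [pullbackModel_congr heq, pullbackModel_comp _ (hg.contDiffAt.differentiableAt (by simp)),
    inChart_eq_pullbackModel]
  · rfl
  · exact (contMDiffAt_extChartAt_symm (φ.map_source hz0)).mdifferentiableAt (by simp)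

theorem IsSmooth.contDiffAt_pullbackModel {η : Form I M k} (hη : IsSmooth I η) {ξ : G → M} {y : G}
    (hξ : ContMDiffAt 𝓘(ℝ, G) I ∞ ξ y) : ContDiffAt ℝ ∞ (pullbackModel I ξ η) y := by
  have hg : ContDiffAt ℝ ∞ (extChartAt I (ξ y) ∘ ξ) y :=
    (contMDiffAt_extChartAt.comp y hξ).contDiffAt
  refine ContDiffAt.congr_of_eventuallyEq ?_ (pullbackModel_eventuallyEq_chart hξ η)
  refine ContDiffAt.continuousAlternatingMap_compContinuousLinearMap ?_
    (hg.fderiv_right (by simp))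
  exact ContDiffAt.comp y (hη.contDiffAt (mem_extChartAt_target (ξ y))) hg

/-- The exterior derivative commutes with the pullback along maps from normed spaces. This holds for
every smooth `ξ`, so the exterior derivative can be computed in any chart. -/
theorem extDeriv_pullbackModel {η : Form I M k} (hη : IsSmooth I η) {ξ : G → M} {y : G}
    (hξ : ContMDiffAt 𝓘(ℝ, G) I ∞ ξ y) :
    extDeriv (pullbackModel I ξ η) y = pullbackModel I ξ (d I η) y := by
  have hg : ContMDiffAt 𝓘(ℝ, G) 𝓘(ℝ, E) ∞ (extChartAt I (ξ y) ∘ ξ) y :=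
    contMDiffAt_extChartAt.comp y hξ
  have hη' : DifferentiableAt ℝ (inChart I η (ξ y)) ((extChartAt I (ξ y) ∘ ξ) y) :=
    (hη.contDiffAt (mem_extChartAt_target (ξ y))).differentiableAt (by simp)
  rw [(pullbackModel_eventuallyEq_chart hξ η).extDeriv_eq]
  have h1 := extDeriv_pullback (r := ∞) hη' hg.contDiffAt minSmoothness_two_le
  refine h1.trans ?_
  have h2 : fderiv ℝ (extChartAt I (ξ y) ∘ ξ) y =
      (mfderiv I 𝓘(ℝ, E) (extChartAt I (ξ y)) (ξ y)).comp (mfderiv 𝓘(ℝ, G) I ξ y) := by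
    rw [← mfderiv_eq_fderiv]
    exact mfderiv_comp y ((contMDiffAt_extChartAt (n := ∞)).mdifferentiableAt (by simp))
      (hξ.mdifferentiableAt (by simp))
  rw [h2, pullbackModel, d, I.range_eq_univ, extDerivWithin_univ]
  rfl

theorem inChart_d {η : Form I M k} (hη : IsSmooth I η) {x₀ : M} {y : E}
    (hy : y ∈ (extChartAt I x₀).target) :
    inChart I (d I η) x₀ y = extDeriv (inChart I η x₀) y := by
  rw [inChart_eq_pullbackModel, inChart_eq_pullbackModel,
    extDeriv_pullbackModel hη (contMDiffAt_extChartAt_symm hy)]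

theorem IsSmooth.d {η : Form I M k} (hη : IsSmooth I η) : IsSmooth I (d I η) := by
  refine isSmooth_iff.2 fun x₀ y hy => ?_
  have h : inChart I (DiffForm.d I η) x₀ =ᶠ[𝓝 y] extDeriv (inChart I η x₀) := by
    filter_upwards [(isOpen_extChartAt_target x₀).mem_nhds hy] with z hz using inChart_d hη hz
  refine ContDiffAt.congr_of_eventuallyEq ?_ h
  exact (ContinuousAlternatingMap.alternatizeUncurryFinCLM ℝ E ℝ).contDiff.contDiffAt.comp y
    ((hη.contDiffAt hy).fderiv_right (m := ∞) (by simp))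

theorem IsSmooth.d_d {η : Form I M k} (hη : IsSmooth I η) : DiffForm.d I (DiffForm.d I η) = 0 := by
  funext x
  have hx := mem_extChartAt_target (I := I) x
  have h : inChart I (DiffForm.d I η) x =ᶠ[𝓝 (extChartAt I x x)]
      extDeriv (inChart I η x) := by
    filter_upwards [(isOpen_extChartAt_target x).mem_nhds hx] with z hz using inChart_d hη hz
  rw [DiffForm.d, I.range_eq_univ, extDerivWithin_univ, h.extDeriv_eq,
    extDeriv_extDeriv_apply (r := ∞) (hη.contDiffAt hx) minSmoothness_two_le]
  rfl

variable [I'.Boundaryless] [IsManifold I' ∞ N]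

theorem d_pullback {η : Form I' N k} (hη : IsSmooth I' η) {f : M → N}
    (hf : ContMDiff I I' ∞ f) :
    DiffForm.d I (DiffForm.pullback I I' f η) = DiffForm.pullback I I' f (DiffForm.d I' η) := by
  funext x
  have hx := mem_extChartAt_target (I := I) x
  have hc := contMDiffAt_extChartAt_symm hx
  have hfc : ContMDiffAt 𝓘(ℝ, E) I' ∞ (f ∘ (extChartAt I x).symm) (extChartAt I x x) :=
    ContMDiffAt.comp _ (hf _) hc
  have hxx : (extChartAt I x).symm (extChartAt I x x) = x := extChartAt_to_inv x
  have h : inChart I (DiffForm.pullback I I' f η) x =ᶠ[𝓝 (extChartAt I x x)]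
      pullbackModel I' (f ∘ (extChartAt I x).symm) η := by
    rw [inChart_eq_pullbackModel]
    filter_upwards [(isOpen_extChartAt_target x).mem_nhds hx] with z hz
    exact pullbackModel_pullback ((hf _).mdifferentiableAt (by simp))
      ((contMDiffAt_extChartAt_symm hz).mdifferentiableAt (by simp)) η
  have h2 : f ∘ (extChartAt I x).symm ∘ extChartAt I x =ᶠ[𝓝 x] f := by
    filter_upwards [(isOpen_extChartAt_source x).mem_nhds (mem_extChartAt_source (I := I) x)]
      with z hz
    exact congrArg f ((extChartAt I x).left_inv hz)
  rw [DiffForm.d, I.range_eq_univ, extDerivWithin_univ, h.extDeriv_eq,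
    extDeriv_pullbackModel hη hfc]
  have h3 : (mfderiv I I' f x : E →L[ℝ] E') =
      (mfderiv 𝓘(ℝ, E) I' (f ∘ (extChartAt I x).symm) (extChartAt I x x)).comp
        (mfderiv I 𝓘(ℝ, E) (extChartAt I x) x) := by
    rw [← mfderiv_comp x (hfc.mdifferentiableAt (by simp))
      ((contMDiffAt_extChartAt (n := ∞)).mdifferentiableAt (by simp))]
    exact h2.symm.mfderiv_eq
  have h4 : ∀ (a b : N), a = b → (show E' [⋀^Fin (k+1)]→L[ℝ] ℝ from DiffForm.d I' η a) =
      DiffForm.d I' η b := by rintro a b rfl; rfl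
  have h5 := h4 _ _ (congrArg f hxx)
  refine Eq.trans (b := (show E [⋀^Fin (k+1)]→L[ℝ] ℝ from
    (show E' [⋀^Fin (k+1)]→L[ℝ] ℝ from
    DiffForm.d I' η ((f ∘ (extChartAt I x).symm) (extChartAt I x x))).compContinuousLinearMap
      ((mfderiv 𝓘(ℝ, E) I' (f ∘ (extChartAt I x).symm) (extChartAt I x x)).comp
        (mfderiv I 𝓘(ℝ, E) (extChartAt I x) x)))) rfl ?_
  refine Eq.trans (b := (show E [⋀^Fin (k+1)]→L[ℝ] ℝ from
    (show E' [⋀^Fin (k+1)]→L[ℝ] ℝ from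
    DiffForm.d I' η (f x)).compContinuousLinearMap (mfderiv I I' f x : E →L[ℝ] E'))) ?_ rfl
  rw [h3]
  exact congrArg (fun A => ContinuousAlternatingMap.compContinuousLinearMap A _) h5

end

end DiffForm

/-! ### Submersions -/

namespace DiffForm

variable {E : Type*} [NormedAddCommGroup E] [NormedSpace ℝ E]
  {H : Type*} [TopologicalSpace H] {I : ModelWithCorners ℝ E H}
  {M : Type*} [TopologicalSpace M] [ChartedSpace H M]
  {E' : Type*} [NormedAddCommGroup E'] [NormedSpace ℝ E']
  {H' : Type*} [TopologicalSpace H'] {I' : ModelWithCorners ℝ E' H'}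
  {N : Type*} [TopologicalSpace N] [ChartedSpace H' N]

section

/-- A normal form of `f` near `p`: parametrizations `ξ` of `M` and `κ` of `N` with inverses `Φ` and
`ψ`, in which `f` is the projection `E' × F → E'`. The set `U` is where `ξ` is a good
parametrization. -/
structure SubmersionChart (I : ModelWithCorners ℝ E H) (I' : ModelWithCorners ℝ E' H')
    (f : M → N) (p : M) (F : Type*) [NormedAddCommGroup F] [NormedSpace ℝ F] where
  /-- the domain of the parametrization of `M` -/
  U : Set (E' × F)
  /-- the parametrization of `M` -/
  ξ : E' × F → M
  /-- the chart of `M` -/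
  Φ : M → E' × F
  /-- the parametrization of `N` -/
  κ : E' → N
  /-- the chart of `N` -/
  ψ : N → E'
  isOpen : IsOpen U
  mem : Φ p ∈ U
  ξ_Φ : ξ (Φ p) = p
  left_inv : ∀ z ∈ U, ∀ᶠ p' in 𝓝 (ξ z), ξ (Φ p') = p'
  contMDiffAt_Φ : ContMDiffAt I 𝓘(ℝ, E' × F) ∞ Φ p
  contMDiffAt_ξ : ∀ z ∈ U, ContMDiffAt 𝓘(ℝ, E' × F) I ∞ ξ z
  right_inv : ∀ z ∈ U, Φ (ξ z) = z
  contMDiffAt_Φ' : ∀ z ∈ U, ContMDiffAt I 𝓘(ℝ, E' × F) ∞ Φ (ξ z)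
  contMDiffAt_κ : ∀ z ∈ U, ContMDiffAt 𝓘(ℝ, E') I' ∞ κ z.1
  contMDiffAt_ψ : ∀ z ∈ U, ContMDiffAt I' 𝓘(ℝ, E') ∞ ψ (κ z.1)
  ψ_κ : ∀ z ∈ U, ψ (κ z.1) = z.1
  κ_ψ : ∀ᶠ x in 𝓝 (f p), κ (ψ x) = x
  map_ξ : ∀ z ∈ U, f (ξ z) = κ z.1

/-- The charts in the definition of a submersion, composed with the linear equivalence of the model
space with `E' × F`. -/
theorem exists_submersionChart [I.Boundaryless] [I'.Boundaryless] {f : M → N} {p : M} {F : Type*}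
    [NormedAddCommGroup F] [NormedSpace ℝ F]
    (h : Manifold.IsSubmersionAtOfComplement F I I' ∞ f p) :
    Nonempty (SubmersionChart I I' f p F) := by
  set a := h.domChart
  set b := h.codChart
  set e := h.equiv
  have ha := h.domChart_mem_maximalAtlas
  have hb := h.codChart_mem_maximalAtlas
  have hpa : p ∈ a.source := h.mem_domChart_source
  have hpb : f p ∈ b.source := h.mem_codChart_source
  have htgt : ∀ y ∈ (a.extend I).target, (e y).1 ∈ (b.extend I').target :=
    h.target_subset_preimage_target
  have hsrc : ∀ y ∈ (a.extend I).target, (a.extend I).symm y ∈ a.source := fun y hy => by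
    simpa using (a.extend I).map_target hy
  have hsrcb : ∀ x ∈ (b.extend I').target, (b.extend I').symm x ∈ b.source := fun y hy => by
    simpa using (b.extend I').map_target hy
  have he : ContDiff ℝ ∞ e := e.contDiff
  have hes : ContDiff ℝ ∞ e.symm := e.symm.contDiff
  exact ⟨{
    U := e.symm ⁻¹' (a.extend I).target
    ξ := (a.extend I).symm ∘ e.symm
    Φ := e ∘ a.extend I
    κ := (b.extend I').symm
    ψ := b.extend I'
    isOpen := a.isOpen_extend_target.preimage e.symm.continuous
    mem := by
      simpa using (a.extend I).map_source (by simpa using hpa)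
    ξ_Φ := by simpa using a.extend_left_inv (I := I) hpa
    left_inv := fun z hz => by
      filter_upwards [a.open_source.mem_nhds (hsrc _ hz)] with w hw
      simpa using a.extend_left_inv (I := I) hw
    contMDiffAt_Φ := he.contMDiff.contMDiffAt.comp p
      (OpenPartialHomeomorph.contMDiffAt_extend ha hpa)
    contMDiffAt_ξ := fun z hz =>
      ((contMDiffOn_extend_symm ha).contMDiffAt (by
        rw [← a.extend_target']
        exact a.isOpen_extend_target.mem_nhds hz)).comp z hes.contMDiff.contMDiffAt
    right_inv := fun z hz => by
      simp only [Function.comp_apply]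
      rw [(a.extend I).right_inv hz]
      simp
    contMDiffAt_Φ' := fun z hz => he.contMDiff.contMDiffAt.comp _
      (OpenPartialHomeomorph.contMDiffAt_extend ha (hsrc _ hz))
    contMDiffAt_κ := fun z hz => (contMDiffOn_extend_symm hb).contMDiffAt (by
      rw [← b.extend_target']
      have := htgt _ hz
      rw [e.apply_symm_apply] at this
      exact b.isOpen_extend_target.mem_nhds this)
    contMDiffAt_ψ := fun z hz => OpenPartialHomeomorph.contMDiffAt_extend hb (hsrcb _ (by
      have := htgt _ hz
      rwa [e.apply_symm_apply] at this))
    ψ_κ := fun z hz => (b.extend I').right_inv (by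
      have := htgt _ hz
      rwa [e.apply_symm_apply] at this)
    κ_ψ := by
      filter_upwards [b.open_source.mem_nhds hpb] with z hz
      exact b.extend_left_inv (I := I') hz
    map_ξ := fun z hz => by
      have h1 := h.writtenInCharts hz
      have h2 : f ((a.extend I).symm (e.symm z)) ∈ b.source :=
        h.source_subset_preimage_source (hsrc _ hz)
      have h3 : b.extend I' (f ((a.extend I).symm (e.symm z))) = z.1 := by
        refine h1.trans ?_
        change (e (e.symm z)).1 = _
        rw [e.apply_symm_apply]
      rw [← h3]
      exact (b.extend_left_inv (I := I') h2).symm }⟩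

namespace SubmersionChart

variable {f : M → N} {p : M} {F : Type*} [NormedAddCommGroup F] [NormedSpace ℝ F]
  (c : SubmersionChart I I' f p F)

include c

theorem κ_Φ : c.κ (c.Φ p).1 = f p := by rw [← c.map_ξ _ c.mem, c.ξ_Φ]

theorem ψ_map : c.ψ (f p) = (c.Φ p).1 := by rw [← c.κ_Φ, c.ψ_κ _ c.mem]

theorem exists_localSection : ∃ σ : N → M, ContMDiffAt I' I ∞ σ (f p) ∧ σ (f p) = p ∧
    ∀ᶠ x in 𝓝 (f p), f (σ x) = x := by
  have hψ : ContMDiffAt I' 𝓘(ℝ, E') ∞ c.ψ (f p) := by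
    have := c.contMDiffAt_ψ _ c.mem
    rwa [c.κ_Φ] at this
  have hs : ContMDiffAt I' 𝓘(ℝ, E' × F) ∞ (fun x => (c.ψ x, (c.Φ p).2)) (f p) :=
    hψ.prodMk_space contMDiffAt_const
  have hp : (c.ψ (f p), (c.Φ p).2) = c.Φ p := by rw [c.ψ_map]
  refine ⟨fun x => c.ξ (c.ψ x, (c.Φ p).2), ?_, ?_, ?_⟩
  · refine ContMDiffAt.comp (I' := 𝓘(ℝ, E' × F)) (f p) ?_ hs
    exact c.contMDiffAt_ξ _ (by rw [hp]; exact c.mem)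
  · simp only [hp, c.ξ_Φ]
  · have h1 : ∀ᶠ x in 𝓝 (f p), (c.ψ x, (c.Φ p).2) ∈ c.U :=
      hs.continuousAt.eventually (c.isOpen.mem_nhds (by
        change (c.ψ (f p), (c.Φ p).2) ∈ c.U
        rw [hp]; exact c.mem))
    filter_upwards [h1, c.κ_ψ] with x hx hx'
    rw [c.map_ξ _ hx]
    exact hx'

theorem mfderiv_ξ_surjective {z : E' × F} (hz : z ∈ c.U) (w : TangentSpace I (c.ξ z)) :
    ∃ u : E' × F, mfderiv 𝓘(ℝ, E' × F) I c.ξ z u = w := by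
  have h1 : MDifferentiableAt I 𝓘(ℝ, E' × F) c.Φ (c.ξ z) :=
    (c.contMDiffAt_Φ' z hz).mdifferentiableAt (by simp)
  have h2 : MDifferentiableAt 𝓘(ℝ, E' × F) I c.ξ (c.Φ (c.ξ z)) := by
    rw [c.right_inv z hz]
    exact (c.contMDiffAt_ξ z hz).mdifferentiableAt (by simp)
  have h3 := mfderiv_comp (c.ξ z) h2 h1
  have h4 : c.ξ ∘ c.Φ =ᶠ[𝓝 (c.ξ z)] id := c.left_inv z hz
  rw [h4.mfderiv_eq, mfderiv_id, c.right_inv z hz] at h3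
  exact ⟨mfderiv I 𝓘(ℝ, E' × F) c.Φ (c.ξ z) w, (DFunLike.congr_fun h3 w).symm⟩

theorem mfderiv_map_ξ {z : E' × F} (hz : z ∈ c.U) (hf : MDifferentiableAt I I' f (c.ξ z))
    (u : E' × F) : (mfderiv I I' f (c.ξ z) (mfderiv 𝓘(ℝ, E' × F) I c.ξ z u) : E') =
      mfderiv 𝓘(ℝ, E') I' c.κ z.1 u.1 := by
  have h2 : MDifferentiableAt 𝓘(ℝ, E' × F) I c.ξ z :=
    (c.contMDiffAt_ξ z hz).mdifferentiableAt (by simp)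
  have h3 : MDifferentiableAt 𝓘(ℝ, E') I' c.κ z.1 :=
    (c.contMDiffAt_κ z hz).mdifferentiableAt (by simp)
  have h4 : f ∘ c.ξ =ᶠ[𝓝 z] c.κ ∘ Prod.fst := by
    filter_upwards [c.isOpen.mem_nhds hz] with z' hz' using c.map_ξ z' hz'
  have h5 : (mfderiv 𝓘(ℝ, E' × F) I' (f ∘ c.ξ) z : E' × F →L[ℝ] E') =
      mfderiv 𝓘(ℝ, E' × F) I' (c.κ ∘ Prod.fst) z := h4.mfderiv_eq
  have h6 : MDifferentiableAt 𝓘(ℝ, E' × F) 𝓘(ℝ, E') (Prod.fst : E' × F → E') z :=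
    differentiableAt_fst.mdifferentiableAt
  have h7 : (mfderiv 𝓘(ℝ, E' × F) I' (c.κ ∘ Prod.fst) z : E' × F →L[ℝ] E') =
      (mfderiv 𝓘(ℝ, E') I' c.κ z.1 : E' →L[ℝ] E').comp (ContinuousLinearMap.fst ℝ E' F) := by
    refine (mfderiv_comp z h3 h6).trans ?_
    rw [mfderiv_eq_fderiv, fderiv_fst]
    rfl
  have h8 : (mfderiv 𝓘(ℝ, E' × F) I' (f ∘ c.ξ) z : E' × F →L[ℝ] E') =
      (mfderiv I I' f (c.ξ z)).comp (mfderiv 𝓘(ℝ, E' × F) I c.ξ z) := mfderiv_comp z hf h2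
  rw [h8, h7] at h5
  exact DFunLike.congr_fun h5 u

theorem mfderiv_κ_injective {z : E' × F} (hz : z ∈ c.U) :
    Function.Injective (mfderiv 𝓘(ℝ, E') I' c.κ z.1) := by
  have h1 : MDifferentiableAt I' 𝓘(ℝ, E') c.ψ (c.κ z.1) :=
    (c.contMDiffAt_ψ z hz).mdifferentiableAt (by simp)
  have h3 : MDifferentiableAt 𝓘(ℝ, E') I' c.κ z.1 :=
    (c.contMDiffAt_κ z hz).mdifferentiableAt (by simp)
  have h4 : c.ψ ∘ c.κ =ᶠ[𝓝 z.1] id := by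
    have h := (c.isOpen.preimage (Continuous.prodMk_left z.2)).mem_nhds (x := z.1) hz
    filter_upwards [h] with a ha using c.ψ_κ (a, z.2) ha
  have h5 := mfderiv_comp z.1 h1 h3
  rw [h4.mfderiv_eq, mfderiv_id] at h5
  intro a b hab
  have h6 := DFunLike.congr_fun h5 a
  have h7 := DFunLike.congr_fun h5 b
  exact h6.trans ((congrArg _ hab).trans h7.symm)

/-- Every vector in the kernel of the differential of a submersion is the velocity of a curve in
the fibre. -/
theorem exists_curve_in_fibre (hf : MDifferentiableAt I I' f p) {w : TangentSpace I p}
    (hw : mfderiv I I' f p w = 0) :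
    ∃ γ : ℝ → M, γ 0 = p ∧ MDifferentiableAt 𝓘(ℝ, ℝ) I γ 0 ∧
      (mfderiv 𝓘(ℝ, ℝ) I γ 0 (1 : ℝ) : E) = w ∧ ∀ᶠ r in 𝓝 (0 : ℝ), f (γ r) = f p := by
  obtain ⟨u, hu⟩ : ∃ u : E' × F, (mfderiv 𝓘(ℝ, E' × F) I c.ξ (c.Φ p) u : E) = w := by
    have := c.mfderiv_ξ_surjective c.mem
    rw [c.ξ_Φ] at this
    exact this w
  have hu1 : u.1 = 0 := by
    have h1 := c.mfderiv_map_ξ c.mem (by rwa [c.ξ_Φ]) u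
    have h2 : (mfderiv I I' f (c.ξ (c.Φ p)) (mfderiv 𝓘(ℝ, E' × F) I c.ξ (c.Φ p) u) : E') = 0 := by
      have h3 : ∀ q : M, q = p → ∀ a : E, a = w → (mfderiv I I' f q a : E') = 0 := by
        rintro q rfl a rfl
        exact hw
      exact h3 _ c.ξ_Φ _ hu
    refine c.mfderiv_κ_injective c.mem ?_
    exact (h1.symm.trans h2).trans (map_zero (mfderiv 𝓘(ℝ, E') I' c.κ (c.Φ p).1)).symm
  have hg : HasFDerivAt (fun r : ℝ => c.Φ p + r • u)
      ((1 : ℝ →L[ℝ] ℝ).smulRight u) 0 := by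
    have := ((1 : ℝ →L[ℝ] ℝ).smulRight u).hasFDerivAt (x := (0 : ℝ))
    exact this.const_add (c.Φ p)
  have hg0 : c.Φ p + (0 : ℝ) • u = c.Φ p := by simp
  have hξ : MDifferentiableAt 𝓘(ℝ, E' × F) I c.ξ (c.Φ p + (0 : ℝ) • u) := by
    rw [hg0]
    exact (c.contMDiffAt_ξ _ c.mem).mdifferentiableAt (by simp)
  have hm : MDifferentiableAt 𝓘(ℝ, ℝ) 𝓘(ℝ, E' × F) (fun r : ℝ => c.Φ p + r • u) 0 :=
    hg.differentiableAt.mdifferentiableAt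
  refine ⟨c.ξ ∘ fun r : ℝ => c.Φ p + r • u, ?_,
    MDifferentiableAt.comp (0 : ℝ) hξ hm, ?_, ?_⟩
  · simp only [Function.comp_apply, hg0, c.ξ_Φ]
  · have h1 : (mfderiv 𝓘(ℝ, ℝ) I (c.ξ ∘ fun r : ℝ => c.Φ p + r • u) 0 (1 : ℝ) : E) =
        mfderiv 𝓘(ℝ, E' × F) I c.ξ (c.Φ p + (0 : ℝ) • u) u := by
      have h := mfderiv_comp (0 : ℝ) hξ hm
      rw [mfderiv_eq_fderiv, hg.fderiv] at h
      refine (DFunLike.congr_fun h (1 : ℝ)).trans ?_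
      change mfderiv 𝓘(ℝ, E' × F) I c.ξ (c.Φ p + (0 : ℝ) • u) ((1 : ℝ) • u) = _
      rw [one_smul]
    rw [h1, ← hu, hg0]
  · have h1 : ∀ᶠ r in 𝓝 (0 : ℝ), c.Φ p + r • u ∈ c.U :=
      hg.continuousAt.eventually (c.isOpen.mem_nhds (by simpa using c.mem))
    filter_upwards [h1] with r hr
    rw [Function.comp_apply, c.map_ξ _ hr]
    simp [hu1, c.κ_Φ]

end SubmersionChart
end

end DiffForm

/-! ### Descent of basic forms along submersions -/

theorem extDeriv_one_form_apply {G : Type*} [NormedAddCommGroup G] [NormedSpace ℝ G]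
    {β : G → G [⋀^Fin 1]→L[ℝ] ℝ} {z : G} (hβ : DifferentiableAt ℝ β z) (a b : G) :
    extDeriv β z ![a, b] =
      fderiv ℝ (fun z => β z ![b]) z a - fderiv ℝ (fun z => β z ![a]) z b := by
  have h0 : (0 : Fin 2).removeNth ![a, b] = ![b] := by
    ext i
    fin_cases i
    rfl
  have h1 : (1 : Fin 2).removeNth ![a, b] = ![a] := by
    ext i
    fin_cases i
    rfl
  rw [extDeriv_apply hβ, Fin.sum_univ_two, h0, h1]
  simp [sub_eq_add_neg]

theorem ContDiffAt.continuousAlternatingMap_apply {G E : Type*} [NormedAddCommGroup G]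
    [NormedSpace ℝ G] [NormedAddCommGroup E] [NormedSpace ℝ E] {k : ℕ} {r : ℕ∞ω}
    {β : G → E [⋀^Fin k]→L[ℝ] ℝ} {z : G} (hβ : ContDiffAt ℝ r β z) (u : Fin k → E) :
    ContDiffAt ℝ r (fun z => β z u) z := by
  have h := (ContinuousAlternatingMap.toContinuousMultilinearMapCLM (𝕜 := ℝ) (E := E) (F := ℝ)
    (ι := Fin k) ℝ).contDiff.contDiffAt.comp z hβ
  exact (ContinuousMultilinearMap.apply ℝ (fun _ : Fin k => E) ℝ u).contDiff.contDiffAt.comp z h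

namespace DiffForm

variable {E : Type*} [NormedAddCommGroup E] [NormedSpace ℝ E]
  {H : Type*} [TopologicalSpace H] {I : ModelWithCorners ℝ E H}
  {M : Type*} [TopologicalSpace M] [ChartedSpace H M]
  {E' : Type*} [NormedAddCommGroup E'] [NormedSpace ℝ E']
  {H' : Type*} [TopologicalSpace H'] {I' : ModelWithCorners ℝ E' H'}
  {N : Type*} [TopologicalSpace N] [ChartedSpace H' N]
  {G : Type*} [NormedAddCommGroup G] [NormedSpace ℝ G]

theorem pullbackModel_apply_two {ξ : G → M} (η : Form I M 2) (z a b : G) :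
    pullbackModel I ξ η z ![a, b] =
      η (ξ z) ![mfderiv 𝓘(ℝ, G) I ξ z a, mfderiv 𝓘(ℝ, G) I ξ z b] := by
  change η (ξ z) _ = _
  congr 1
  ext i
  fin_cases i <;> rfl

theorem pullback_toForm {f : M → N} (α : Covector I' N) :
    pullback I I' f (Covector.toForm I' α) =
      Covector.toForm I (fun p => (α (f p)).comp (mfderiv I I' f p)) := rfl

section

variable {f : M → N} {p : M} {F : Type*} [NormedAddCommGroup F] [NormedSpace ℝ F]
  [I.Boundaryless] [IsManifold I ∞ M]

/-- A smooth `1`-form `α` which, together with `dα`, vanishes on the kernel of the differential of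
a submersion is locally constant along the fibres. -/
theorem SubmersionChart.eventually_covector_eq (c : SubmersionChart I I' f p F)
    (hf : ContMDiff I I' ∞ f) {α : Covector I M} (hα : IsSmooth I (Covector.toForm I α))
    (hker : ∀ (q : M) (w : TangentSpace I q), mfderiv I I' f q w = 0 → α q w = 0)
    (hd : ∀ (q : M) (w u : TangentSpace I q), mfderiv I I' f q w = 0 →
      d I (Covector.toForm I α) q ![w, u] = 0) :
    ∀ᶠ q in 𝓝 p, f q = f p → ∀ (w : TangentSpace I p) (w' : TangentSpace I q),
      (mfderiv I I' f p w : E') = mfderiv I I' f q w' → α p w = α q w' := by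
  set β := pullbackModel I c.ξ (Covector.toForm I α)
  have hfd : ∀ q, MDifferentiableAt I I' f q := fun q => (hf q).mdifferentiableAt (by simp)
  have hβ : ∀ z ∈ c.U, ContDiffAt ℝ ∞ β z := fun z hz =>
    hα.contDiffAt_pullbackModel (c.contMDiffAt_ξ z hz)
  have hvert : ∀ z ∈ c.U, ∀ v : F, mfderiv I I' f (c.ξ z)
      (mfderiv 𝓘(ℝ, E' × F) I c.ξ z ((0, v) : E' × F)) = 0 := fun z hz v =>
    (c.mfderiv_map_ξ hz (hfd _) (0, v)).trans (map_zero (mfderiv 𝓘(ℝ, E') I' c.κ z.1))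
  have hβ0 : ∀ z ∈ c.U, ∀ v : F, β z ![(0, v)] = 0 := fun z hz v =>
    hker _ _ (hvert z hz v)
  -- the coefficients of `β` have vanishing derivative along the fibre directions
  have hβ1 : ∀ z ∈ c.U, ∀ (v : F) (u : E' × F), fderiv ℝ (fun z => β z ![u]) z (0, v) = 0 := by
    intro z hz v u
    have h1 := extDeriv_one_form_apply ((hβ z hz).differentiableAt (by simp)) (0, v) u
    have h2 : extDeriv β z ![(0, v), u] = 0 := by
      rw [extDeriv_pullbackModel hα (c.contMDiffAt_ξ z hz), pullbackModel_apply_two]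
      exact hd _ _ _ (hvert z hz v)
    have h3 : (fun z => β z ![((0 : E'), v)]) =ᶠ[𝓝 z] fun _ => 0 := by
      filter_upwards [c.isOpen.mem_nhds hz] with z' hz' using hβ0 z' hz' v
    rw [h2, h3.fderiv_eq] at h1
    simpa using h1.symm
  obtain ⟨r, hr, hball⟩ := Metric.isOpen_iff.1 c.isOpen _ c.mem
  -- hence these coefficients are constant on the convex slices of a ball
  have hconst : ∀ z ∈ Metric.ball (c.Φ p) r, z.1 = (c.Φ p).1 → ∀ u : E' × F,
      β (c.Φ p) ![u] = β z ![u] := by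
    intro z hz hz1 u
    have hin : ∀ v ∈ Metric.ball (c.Φ p).2 r, ((c.Φ p).1, v) ∈ c.U := fun v hv => by
      refine hball ?_
      rw [Metric.mem_ball, Prod.dist_eq]
      simpa [hr] using hv
    have hder : ∀ v ∈ Metric.ball (c.Φ p).2 r,
        HasFDerivAt (fun v : F => β ((c.Φ p).1, v) ![u]) (0 : F →L[ℝ] ℝ) v := by
      intro v hv
      have h1 : HasFDerivAt (fun z => β z ![u]) (fderiv ℝ (fun z => β z ![u]) ((c.Φ p).1, v))
          ((c.Φ p).1, v) :=
        (((hβ _ (hin v hv)).continuousAlternatingMap_apply ![u]).differentiableAt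
          (by simp)).hasFDerivAt
      have h2 := h1.comp v (hasFDerivAt_prodMk_right (c.Φ p).1 v)
      convert! h2 using 1
      ext v'
      exact (hβ1 _ (hin v hv) v' u).symm
    have h := Metric.isOpen_ball.is_const_of_fderiv_eq_zero
      (convex_ball (c.Φ p).2 r).isPreconnected
      (fun v hv => (hder v hv).differentiableAt.differentiableWithinAt)
      (fun v hv => (hder v hv).fderiv) (Metric.mem_ball_self hr) (y := z.2) (by
        rw [Metric.mem_ball, Prod.dist_eq] at hz
        exact (le_max_right _ _).trans_lt hz)
    have hz' : z = ((c.Φ p).1, z.2) := by rw [← hz1]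
    rw [hz']
    exact h
  have hloc : ∀ᶠ q in 𝓝 p, c.Φ q ∈ Metric.ball (c.Φ p) r :=
    c.contMDiffAt_Φ.continuousAt.eventually (Metric.ball_mem_nhds _ hr)
  have hinv : ∀ᶠ q in 𝓝 p, c.ξ (c.Φ q) = q := by
    have := c.left_inv _ c.mem
    rwa [c.ξ_Φ] at this
  filter_upwards [hloc, hinv] with q hq hqinv hfq w w' hww
  have hqU := hball hq
  have hq1 : (c.Φ q).1 = (c.Φ p).1 := by
    rw [← c.ψ_κ _ hqU, ← c.map_ξ _ hqU, hqinv, hfq, c.ψ_map]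
  obtain ⟨u, hu⟩ : ∃ u : E' × F, (mfderiv 𝓘(ℝ, E' × F) I c.ξ (c.Φ p) u : E) = w := by
    have := c.mfderiv_ξ_surjective c.mem
    rw [c.ξ_Φ] at this
    exact this w
  obtain ⟨u', hu'⟩ : ∃ u : E' × F, (mfderiv 𝓘(ℝ, E' × F) I c.ξ (c.Φ q) u : E) = w' := by
    have := c.mfderiv_ξ_surjective hqU
    rw [hqinv] at this
    exact this w'
  -- transport along the equalities `ξ (Φ p) = p` and `ξ (Φ q) = q`
  have transport : ∀ (a b : M) (x : E) (y : TangentSpace I b), a = b → x = y →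
      (mfderiv I I' f a x : E') = mfderiv I I' f b y ∧ α a x = α b y := by
    rintro a b x y rfl rfl
    exact ⟨rfl, rfl⟩
  have tp := transport _ _ _ w c.ξ_Φ hu
  have tq := transport _ _ _ w' hqinv hu'
  have m1 := c.mfderiv_map_ξ c.mem (hfd _) u
  have m2 := c.mfderiv_map_ξ hqU (hfd _) u'
  have huu : u.1 = u'.1 := by
    refine c.mfderiv_κ_injective c.mem ?_
    have m3 : (mfderiv 𝓘(ℝ, E') I' c.κ (c.Φ q).1 u'.1 : E') =
        mfderiv 𝓘(ℝ, E') I' c.κ (c.Φ p).1 u'.1 := by rw [hq1]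
    exact m1.symm.trans (tp.1.trans (hww.trans (tq.1.symm.trans (m2.trans m3))))
  have split : ∀ z ∈ c.U, ∀ u : E' × F, β z ![u] = β z ![(u.1, 0)] := by
    intro z hz u
    have h1 := hβ0 z hz u.2
    have h2 : (u.1, (0 : F)) + (0, u.2) = u := by ext <;> simp
    have h3 : β z ![(u.1, (0 : F)) + (0, u.2)] = β z ![(u.1, 0)] + β z ![(0, u.2)] := by
      exact map_add ((α (c.ξ z)).comp (mfderiv 𝓘(ℝ, E' × F) I c.ξ z)) _ _
    rw [h2, h1, add_zero] at h3
    exact h3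
  rw [← tp.2, ← tq.2]
  change β (c.Φ p) ![u] = β (c.Φ q) ![u']
  rw [split _ c.mem, split _ hqU, hconst _ hq hq1, huu]

end

section Descent

variable {f : M → N} [I.Boundaryless] [I'.Boundaryless]

theorem exists_localSection (hf : Manifold.IsSubmersion I I' ∞ f) (p : M) :
    ∃ σ : N → M, ContMDiffAt I' I ∞ σ (f p) ∧ σ (f p) = p ∧ ∀ᶠ x in 𝓝 (f p), f (σ x) = x := by
  obtain ⟨F, _, _, hF⟩ := hf
  obtain ⟨c⟩ := exists_submersionChart (hF p)
  exact c.exists_localSection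

/-- The differential of a submersion has a continuous linear right inverse. -/
theorem exists_rightInverse_mfderiv (hf : Manifold.IsSubmersion I I' ∞ f) (p : M) :
    ∃ R : TangentSpace I' (f p) →L[ℝ] TangentSpace I p,
      ∀ X, mfderiv I I' f p (R X) = X := by
  obtain ⟨σ, hσ, hσp, hfσ⟩ := exists_localSection hf p
  have h1 : MDifferentiableAt I I' f (σ (f p)) := (hf.contMDiff _).mdifferentiableAt (by simp)
  have h2 := mfderiv_comp (f p) h1 (hσ.mdifferentiableAt (by simp))
  have h3 : f ∘ σ =ᶠ[𝓝 (f p)] id := hfσ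
  rw [h3.mfderiv_eq, mfderiv_id, hσp] at h2
  exact ⟨mfderiv I' I σ (f p), fun X => (DFunLike.congr_fun h2 X).symm⟩

theorem mfderiv_surjective (hf : Manifold.IsSubmersion I I' ∞ f) (p : M) :
    Function.Surjective (mfderiv I I' f p) := fun X => by
  obtain ⟨R, hR⟩ := exists_rightInverse_mfderiv hf p
  exact ⟨R X, hR X⟩

theorem pullback_injective (hf : Manifold.IsSubmersion I I' ∞ f) (hsurj : Function.Surjective f)
    {k : ℕ} {η η' : Form I' N k} (h : pullback I I' f η = pullback I I' f η') : η = η' := by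
  funext x
  obtain ⟨p, rfl⟩ := hsurj x
  obtain ⟨R, hR⟩ := exists_rightInverse_mfderiv hf p
  ext v
  have h1 := DFunLike.congr_fun (congrFun h p) (fun i => R (v i))
  have h2 : (fun i => mfderiv I I' f p (R (v i))) = v := funext fun i => hR (v i)
  change η (f p) (fun i => mfderiv I I' f p (R (v i))) =
    η' (f p) (fun i => mfderiv I I' f p (R (v i))) at h1
  rwa [h2] at h1

theorem contMDiff_of_comp_submersion (hf : Manifold.IsSubmersion I I' ∞ f)
    (hsurj : Function.Surjective f) {g : N → G} (hg : ContMDiff I 𝓘(ℝ, G) ∞ (g ∘ f)) :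
    ContMDiff I' 𝓘(ℝ, G) ∞ g := by
  intro x
  obtain ⟨p, rfl⟩ := hsurj x
  obtain ⟨σ, hσ, hσp, hfσ⟩ := exists_localSection hf p
  refine (ContMDiffAt.comp (f p) (hg (σ (f p))) hσ).congr_of_eventuallyEq ?_
  filter_upwards [hfσ] with x hx
  simp [hx]

variable [IsManifold I ∞ M] [IsManifold I' ∞ N]

/-- A form with smooth pullback along a surjective submersion is smooth: locally it is the pullback
of its pullback along a section. -/
theorem isSmooth_of_pullback (hf : Manifold.IsSubmersion I I' ∞ f)
    (hsurj : Function.Surjective f) {k : ℕ} {η : Form I' N k}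
    (h : IsSmooth I (pullback I I' f η)) : IsSmooth I' η := by
  refine isSmooth_iff.2 fun x₀ y hy => ?_
  set φ := extChartAt I' x₀
  obtain ⟨p, hp⟩ := hsurj (φ.symm y)
  obtain ⟨σ, hσ, hσp, hfσ⟩ := exists_localSection hf p
  rw [hp] at hσ hσp hfσ
  have hc : ContMDiffAt 𝓘(ℝ, E') I' ∞ φ.symm y := contMDiffAt_extChartAt_symm hy
  have hσc : ContMDiffAt 𝓘(ℝ, E') I ∞ (σ ∘ φ.symm) y := hσ.comp y hc
  rw [inChart_eq_pullbackModel]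
  refine (h.contDiffAt_pullbackModel hσc).congr_of_eventuallyEq ?_
  have h1 : f ∘ (σ ∘ φ.symm) =ᶠ[𝓝 y] φ.symm := hc.continuousAt.eventually hfσ
  have h2 : ∀ᶠ z in 𝓝 y, ContMDiffAt 𝓘(ℝ, E') I 1 (σ ∘ φ.symm) z :=
    (contMDiffAt_iff_contMDiffAt_nhds (by simp)).1 (hσc.of_le (by simp))
  filter_upwards [h1.eventually_nhds, h2] with z hz hz2
  rw [pullbackModel_pullback ((hf.contMDiff _).mdifferentiableAt (by simp))
    (hz2.mdifferentiableAt (by simp))]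
  exact (pullbackModel_congr hz η).symm

/-- A smooth `1`-form `α` such that `α` and `dα` vanish on the kernel of the differential of a
surjective submersion with connected fibres is the pullback of a smooth `1`-form. -/
theorem exists_pullback_eq (hf : Manifold.IsSubmersion I I' ∞ f) (hsurj : Function.Surjective f)
    (hconn : ∀ x, IsPreconnected (f ⁻¹' {x})) {α : Covector I M}
    (hα : IsSmooth I (Covector.toForm I α))
    (hker : ∀ (q : M) (w : TangentSpace I q), mfderiv I I' f q w = 0 → α q w = 0)
    (hd : ∀ (q : M) (w u : TangentSpace I q), mfderiv I I' f q w = 0 →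
      d I (Covector.toForm I α) q ![w, u] = 0) :
    ∃ θ : Covector I' N, IsSmooth I' (Covector.toForm I' θ) ∧
      pullback I I' f (Covector.toForm I' θ) = Covector.toForm I α := by
  have hsm := hf.contMDiff
  have hloc : ∀ p, ∀ᶠ q in 𝓝 p, f q = f p → ∀ (w : TangentSpace I p) (w' : TangentSpace I q),
      (mfderiv I I' f p w : E') = mfderiv I I' f q w' → α p w = α q w' := by
    obtain ⟨F, _, _, hF⟩ := hf
    intro p
    obtain ⟨c⟩ := exists_submersionChart (hF p)
    exact c.eventually_covector_eq hsm hα hker hd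
  have hglob : ∀ p q, f q = f p → ∀ (w : TangentSpace I p) (w' : TangentSpace I q),
      (mfderiv I I' f p w : E') = mfderiv I I' f q w' → α p w = α q w' := by
    intro p q hpq
    refine (hconn (f p)).induction₂ (fun a b => ∀ (w : TangentSpace I a) (w' : TangentSpace I b),
      (mfderiv I I' f a w : E') = mfderiv I I' f b w' → α a w = α b w') ?_ ?_ ?_ rfl hpq
    · intro a ha
      filter_upwards [nhdsWithin_le_nhds (hloc a), self_mem_nhdsWithin] with b hb hb'
      exact hb (Eq.trans (b := f p) hb' (Eq.symm ha))
    · intro a b c _ hb _ hab hbc w w' hww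
      have key : ∃ w'' : TangentSpace I b, (mfderiv I I' f b w'' : E') = mfderiv I I' f a w :=
        mfderiv_surjective hf b _
      obtain ⟨w'', hw''⟩ := key
      exact (hab w w'' hw''.symm).trans (hbc w'' w' (hw''.trans hww))
    · intro a b _ _ hab w w' hww
      exact (hab w' w hww.symm).symm
  choose σ hσ using hsurj
  choose R hR using exists_rightInverse_mfderiv hf
  -- By the independence just shown, the choice of the points `σ x` in the fibres is immaterial.
  let θ : Covector I' N := fun x => ((α (σ x)).comp (R (σ x)) : E' →L[ℝ] ℝ)
  have hθ : pullback I I' f (Covector.toForm I' θ) = Covector.toForm I α := by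
    rw [pullback_toForm]
    congr 1
    funext p
    ext w
    exact hglob _ _ (hσ (f p)).symm _ _ (hR (σ (f p)) (mfderiv I I' f p w))
  refine ⟨θ, isSmooth_of_pullback hf (fun x => ⟨σ x, hσ x⟩) ?_, hθ⟩
  rwa [hθ]

end Descent

end DiffForm

/-! ### Hamiltonian vector fields -/

namespace ContinuousAlternatingMap

variable {E : Type*} [NormedAddCommGroup E] [NormedSpace ℝ E]

/-- The map `X ↦ i(X) η` of a `2`-form `η` on a normed space, depending linearly on `η`. -/
def flat (E : Type*) [NormedAddCommGroup E] [NormedSpace ℝ E] :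
    (E [⋀^Fin 2]→L[ℝ] ℝ) →L[ℝ] E →L[ℝ] E →L[ℝ] ℝ :=
  (ContinuousLinearMap.compL ℝ E (E [⋀^Fin 1]→L[ℝ] ℝ) (E →L[ℝ] ℝ)
    ((ofSubsingletonLIE (𝕜 := ℝ) (E := E) (F := ℝ) (0 : Fin 1)).symm :
      (E [⋀^Fin 1]→L[ℝ] ℝ) →L[ℝ] E →L[ℝ] ℝ)).comp
    (curryLeftLI : (E [⋀^Fin 2]→L[ℝ] ℝ) →ₗᵢ[ℝ] _).toContinuousLinearMap

theorem contDiff_flat (E : Type*) [NormedAddCommGroup E] [NormedSpace ℝ E] :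
    ContDiff ℝ ∞ (flat E) :=
  ContinuousLinearMap.contDiff (𝕜 := ℝ) (E := E [⋀^Fin 2]→L[ℝ] ℝ)
    (F := E →L[ℝ] E →L[ℝ] ℝ) (flat E)

theorem flat_apply (η : E [⋀^Fin 2]→L[ℝ] ℝ) (a b : E) : flat E η a b = η ![a, b] := by
  change η (Fin.cons a fun _ => b) = _
  congr 1
  ext i
  fin_cases i <;> rfl

theorem bijective_flat [FiniteDimensional ℝ E] {η : E [⋀^Fin 2]→L[ℝ] ℝ}
    (h : ∀ a, (∀ b, η ![a, b] = 0) → a = 0) : Function.Bijective (flat E η) := by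
  have hinj : Function.Injective (flat E η : E →ₗ[ℝ] E →L[ℝ] ℝ) := by
    refine (injective_iff_map_eq_zero _).2 fun a ha => h a fun b => ?_
    rw [← flat_apply]
    exact DFunLike.congr_fun ha b
  have hdim : Module.finrank ℝ E = Module.finrank ℝ (E →L[ℝ] ℝ) := by
    rw [← (LinearMap.toContinuousLinearMap : (E →ₗ[ℝ] ℝ) ≃ₗ[ℝ] (E →L[ℝ] ℝ)).finrank_eq]
    exact Subspace.dual_finrank_eq.symm
  exact ⟨hinj, (LinearMap.injective_iff_surjective_of_finrank_eq_finrank hdim).1 hinj⟩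

end ContinuousAlternatingMap

namespace DiffForm

variable {E : Type*} [NormedAddCommGroup E] [NormedSpace ℝ E]
  {H : Type*} [TopologicalSpace H] {I : ModelWithCorners ℝ E H} [I.Boundaryless]
  {M : Type*} [TopologicalSpace M] [ChartedSpace H M] [IsManifold I ∞ M]

theorem mfderiv_extChartAt_symm_mfderiv_extChartAt {x₀ : M} {y : E}
    (hy : y ∈ (extChartAt I x₀).target) (w : TangentSpace I ((extChartAt I x₀).symm y)) :
    mfderiv 𝓘(ℝ, E) I (extChartAt I x₀).symm y
      (mfderiv I 𝓘(ℝ, E) (extChartAt I x₀) ((extChartAt I x₀).symm y) w) = w := by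
  have h := mfderivWithin_extChartAt_symm_comp_mfderiv_extChartAt (I := I) hy
  rw [I.range_eq_univ, mfderivWithin_univ] at h
  exact DFunLike.congr_fun h w

theorem mfderiv_extChartAt_mfderiv_extChartAt_symm {x₀ : M} {y : E}
    (hy : y ∈ (extChartAt I x₀).target) (u : E) :
    mfderiv I 𝓘(ℝ, E) (extChartAt I x₀) ((extChartAt I x₀).symm y)
      (mfderiv 𝓘(ℝ, E) I (extChartAt I x₀).symm y u) = u := by
  have h := mfderiv_extChartAt_comp_mfderivWithin_extChartAt_symm (I := I) hy
  rw [I.range_eq_univ, mfderivWithin_univ] at h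
  exact DFunLike.congr_fun h u

theorem mfderiv_extChartAt_symm_surjective {x₀ : M} {y : E} (hy : y ∈ (extChartAt I x₀).target)
    (w : TangentSpace I ((extChartAt I x₀).symm y)) :
    ∃ u : E, mfderiv 𝓘(ℝ, E) I (extChartAt I x₀).symm y u = w :=
  ⟨_, mfderiv_extChartAt_symm_mfderiv_extChartAt hy w⟩

/-- A vector field is smooth if its components in the charts are smooth. -/
theorem contMDiffAt_vectorField {X : VField I M} {x₀ : M} {V : E → E}
    (hV : ContDiffAt ℝ ∞ V (extChartAt I x₀ x₀))
    (hX : ∀ y ∈ (extChartAt I x₀).target, X ((extChartAt I x₀).symm y) =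
      mfderiv 𝓘(ℝ, E) I (extChartAt I x₀).symm y (V y)) :
    ContMDiffAt I I.tangent ∞ (fun x => (⟨x, X x⟩ : TangentBundle I M)) x₀ := by
  refine (Bundle.contMDiffAt_section x₀).2 ?_
  have h1 : ContMDiffAt I 𝓘(ℝ, E) ∞ (V ∘ extChartAt I x₀) x₀ :=
    hV.contMDiffAt.comp x₀ contMDiffAt_extChartAt
  refine h1.congr_of_eventuallyEq ?_
  filter_upwards [(isOpen_extChartAt_source (I := I) x₀).mem_nhds (mem_extChartAt_source x₀)]
    with x hx
  have hx' : x ∈ (chartAt H x₀).source := by rwa [← extChartAt_source (I := I)]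
  have h2 := TangentBundle.continuousLinearMapAt_trivializationAt (I := I) hx'
  have h3 : (trivializationAt E (TangentSpace I) x₀ ⟨x, X x⟩).2 =
      (trivializationAt E (TangentSpace I) x₀).continuousLinearMapAt ℝ x (X x) := by
    rw [Bundle.Trivialization.continuousLinearMapAt_apply,
      Bundle.Trivialization.linearMapAt_apply, if_pos (by simpa using hx')]
  have h4 := hX _ ((extChartAt I x₀).map_source hx)
  have h5 := mfderiv_extChartAt_mfderiv_extChartAt_symm ((extChartAt I x₀).map_source hx)
    (V (extChartAt I x₀ x))
  rw [← h4, (extChartAt I x₀).left_inv hx] at h5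
  rw [h3, h2]
  exact h5

theorem mfderiv_extChartAt_symm_comp {G : Type*} [NormedAddCommGroup G] [NormedSpace ℝ G]
    {g : M → G} {x₀ : M} {y : E} (hy : y ∈ (extChartAt I x₀).target)
    (hg : MDifferentiableAt I 𝓘(ℝ, G) g ((extChartAt I x₀).symm y)) (u : E) :
    fderiv ℝ (g ∘ (extChartAt I x₀).symm) y u =
      mfderiv I 𝓘(ℝ, G) g ((extChartAt I x₀).symm y)
        (mfderiv 𝓘(ℝ, E) I (extChartAt I x₀).symm y u) := by
  have h := mfderiv_comp y hg ((contMDiffAt_extChartAt_symm hy).mdifferentiableAt (by simp))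
  rw [mfderiv_eq_fderiv] at h
  exact DFunLike.congr_fun h u

variable [FiniteDimensional ℝ E]

/-- Every smooth function on a symplectic manifold has a unique Hamiltonian vector field, and it is
smooth. -/
theorem IsSymplectic.exists_hamiltonian {η : Form I M 2} (hη : IsSymplectic I η) {g : M → ℝ}
    (hg : ContMDiff I 𝓘(ℝ, ℝ) ∞ g) : ∃ X : VField I M,
      ContMDiff I I.tangent ∞ (fun x => (⟨x, X x⟩ : TangentBundle I M)) ∧
      ∀ x (X' : TangentSpace I x),
        interiorProduct I X' (η x) = mfderiv I 𝓘(ℝ, ℝ) g x ↔ X' = X x := by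
  have hbij : ∀ x, Function.Bijective (ContinuousAlternatingMap.flat E (η x)) := fun x =>
    ContinuousAlternatingMap.bijective_flat fun a ha => hη.nondegenerate x a (by
      ext b
      exact (interiorProduct_apply I (show TangentSpace I x from a) (η x) b).trans (ha b))
  have hflat : ∀ x (X' : TangentSpace I x), interiorProduct I X' (η x) = mfderiv I 𝓘(ℝ, ℝ) g x ↔
      ContinuousAlternatingMap.flat E (η x) X' = mfderiv I 𝓘(ℝ, ℝ) g x := by
    intro x X'
    have h : (interiorProduct I X' (η x) : E →L[ℝ] ℝ) =
        ContinuousAlternatingMap.flat E (η x) X' := by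
      ext b
      exact (interiorProduct_apply I X' (η x) b).trans
        (ContinuousAlternatingMap.flat_apply (E := E) (η x) X' b).symm
    exact ⟨fun h' => h.symm.trans h', fun h' => h.trans h'⟩
  choose X hX using fun x => (hbij x).2 (mfderiv I 𝓘(ℝ, ℝ) g x)
  have huniq : ∀ x (X' : TangentSpace I x),
        interiorProduct I X' (η x) = mfderiv I 𝓘(ℝ, ℝ) g x ↔ X' = X x := by
    intro x X'
    rw [hflat]
    exact ⟨fun h => (hbij x).1 (h.trans (hX x).symm), fun h => by rw [h]; exact hX x⟩
  refine ⟨X, fun x₀ => ?_, huniq⟩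
  set φ := extChartAt I x₀
  have hgd : ∀ x, MDifferentiableAt I 𝓘(ℝ, ℝ) g x := fun x => (hg x).mdifferentiableAt (by simp)
  set B : E → E →L[ℝ] E →L[ℝ] ℝ := fun y => ContinuousAlternatingMap.flat E (inChart I η x₀ y)
  have hBapply : ∀ y a b, B y a b = η (φ.symm y)
      ![mfderiv 𝓘(ℝ, E) I φ.symm y a, mfderiv 𝓘(ℝ, E) I φ.symm y b] := by
    intro y a b
    have h := ContinuousAlternatingMap.flat_apply (inChart I η x₀ y) a b
    rw [inChart_eq_pullbackModel, pullbackModel_apply_two] at h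
    rw [← h, ← inChart_eq_pullbackModel]
  have hBbij : ∀ y ∈ φ.target, Function.Bijective (B y) := fun y hy =>
    ContinuousAlternatingMap.bijective_flat fun a ha => by
      have h1 : mfderiv 𝓘(ℝ, E) I φ.symm y a = 0 := by
        refine hη.nondegenerate _ _ ?_
        ext w
        obtain ⟨b, rfl⟩ := mfderiv_extChartAt_symm_surjective hy w
        rw [interiorProduct_apply, ← hBapply]
        exact (ContinuousAlternatingMap.flat_apply _ a b).trans (ha b)
      have h2 := mfderiv_extChartAt_mfderiv_extChartAt_symm hy a
      rw [h1, map_zero] at h2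
      exact h2.symm
  let e : ∀ y ∈ φ.target, E ≃L[ℝ] (E →L[ℝ] ℝ) := fun y hy =>
    ContinuousLinearEquiv.ofBijective (B y) (LinearMap.ker_eq_bot.2 (hBbij y hy).1)
      (LinearMap.range_eq_top.2 (hBbij y hy).2)
  have he : ∀ y (hy : y ∈ φ.target), (e y hy : E →L[ℝ] E →L[ℝ] ℝ) = B y := fun y hy =>
    ContinuousLinearMap.ext fun _ => rfl
  have hy₀ : φ x₀ ∈ φ.target := mem_extChartAt_target x₀
  refine contMDiffAt_vectorField
    (V := fun y => ContinuousLinearMap.inverse (B y) (fderiv ℝ (g ∘ φ.symm) y)) ?_ ?_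
  · have hB : ContDiffAt ℝ ∞ B (φ x₀) :=
      (ContinuousAlternatingMap.contDiff_flat E).contDiffAt.comp _ (hη.smooth.contDiffAt hy₀)
    refine ContDiffAt.clm_apply ?_ ?_
    · have := FiniteDimensional.complete ℝ E
      have hinv : ContDiffAt ℝ ∞
          (ContinuousLinearMap.inverse : (E →L[ℝ] E →L[ℝ] ℝ) → (E →L[ℝ] ℝ) →L[ℝ] E)
          (B (φ x₀)) := by
        rw [← he _ hy₀]
        exact contDiffAt_map_inverse (e _ hy₀)
      exact hinv.comp (φ x₀) hB
    · have h : ContMDiffAt 𝓘(ℝ, E) 𝓘(ℝ, ℝ) ∞ (g ∘ φ.symm) (φ x₀) :=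
        ContMDiffAt.comp _ (hg _) (contMDiffAt_extChartAt_symm hy₀)
      exact h.contDiffAt.fderiv_right (by simp)
  · intro y hy
    refine ((huniq _ _).1 ?_).symm
    ext w
    obtain ⟨b, rfl⟩ := mfderiv_extChartAt_symm_surjective hy w
    rw [interiorProduct_apply, ← hBapply]
    refine Eq.trans ?_ (mfderiv_extChartAt_symm_comp hy (hgd _) b)
    rw [← he y hy, ContinuousLinearMap.inverse_equiv]
    exact DFunLike.congr_fun ((e y hy).apply_symm_apply _) b

end DiffForm

/-! ### The Poincaré-Cartan form in natural coordinates -/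

namespace TimeDependent.Coord

variable {V : Type*} [NormedAddCommGroup V] [NormedSpace ℝ V]

/-- The vertical endomorphism `(δq, δv, δt) ↦ (0, δq - v δt, 0)` in natural coordinates. -/
def vert (y : (V × V) × ℝ) : (V × V) × ℝ →L[ℝ] (V × V) × ℝ :=
  ((0 : (V × V) × ℝ →L[ℝ] V).prod
    ((ContinuousLinearMap.fst ℝ V V).comp (ContinuousLinearMap.fst ℝ (V × V) ℝ) -
      (ContinuousLinearMap.snd ℝ (V × V) ℝ).smulRight y.1.2)).prod 0

theorem vert_apply (y w : (V × V) × ℝ) : vert y w = ((0, w.1.1 - w.2 • y.1.2), 0) := rfl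

/-- The Poincaré-Cartan form of the Lagrangian `L`. -/
def cartan (L : (V × V) × ℝ → ℝ) (y : (V × V) × ℝ) : (V × V) × ℝ →L[ℝ] ℝ :=
  (fderiv ℝ L y).comp (vert y) + L y • ContinuousLinearMap.snd ℝ (V × V) ℝ

theorem cartan_apply (L : (V × V) × ℝ → ℝ) (y w : (V × V) × ℝ) :
    cartan L y w = fderiv ℝ L y ((0, w.1.1 - w.2 • y.1.2), 0) + L y * w.2 := rfl

/-- The canonical lift of the vector field `∂/∂t + Γ^μ ∂/∂q^μ`. -/
def jet (Γ : V × ℝ → V) (y : (V × V) × ℝ) : (V × V) × ℝ :=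
  ((Γ (y.1.1, y.2), fderiv ℝ Γ (y.1.1, y.2) (y.1.2, 1)), 1)

theorem contDiffAt_cartan {L : (V × V) × ℝ → ℝ} {y : (V × V) × ℝ} (hL : ContDiffAt ℝ ∞ L y) :
    ContDiffAt ℝ ∞ (cartan L) y := by
  have h1 : ContDiffAt ℝ ∞ (vert (V := V)) y := by
    have h : ContDiff ℝ ∞ fun y : (V × V) × ℝ =>
        (ContinuousLinearMap.snd ℝ (V × V) ℝ).smulRight y.1.2 :=
      (ContinuousLinearMap.smulRightL ℝ ((V × V) × ℝ) V
        (ContinuousLinearMap.snd ℝ (V × V) ℝ)).contDiff.comp (by fun_prop)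
    have h2 : ContDiff ℝ ∞ fun y : (V × V) × ℝ =>
        (ContinuousLinearMap.fst ℝ V V).comp (ContinuousLinearMap.fst ℝ (V × V) ℝ) -
          (ContinuousLinearMap.snd ℝ (V × V) ℝ).smulRight y.1.2 := contDiff_const.sub h
    have h3 : vert (V := V) = fun y =>
        ((ContinuousLinearMap.inl ℝ (V × V) ℝ).comp (ContinuousLinearMap.inr ℝ V V)).comp
          ((ContinuousLinearMap.fst ℝ V V).comp (ContinuousLinearMap.fst ℝ (V × V) ℝ) -
            (ContinuousLinearMap.snd ℝ (V × V) ℝ).smulRight y.1.2) := by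
      funext y
      ext w <;> simp [vert_apply]
    rw [h3]
    exact (contDiff_const.clm_comp h2).contDiffAt
  exact ((hL.fderiv_right (m := ∞) (by simp)).clm_comp h1).add (hL.smul contDiffAt_const)

theorem contDiffAt_jet {Γ : V × ℝ → V} {y : (V × V) × ℝ}
    (hΓ : ContDiffAt ℝ ∞ Γ (y.1.1, y.2)) : ContDiffAt ℝ ∞ (jet Γ) y := by
  have h1 : ContDiffAt ℝ ∞ (fun y : (V × V) × ℝ => (y.1.1, y.2)) y := by fun_prop
  have h2 : ContDiffAt ℝ ∞ (fun y : (V × V) × ℝ => (y.1.2, (1 : ℝ))) y := by fun_prop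
  have h3 : ContDiffAt ℝ ∞ (fun y : (V × V) × ℝ => Γ (y.1.1, y.2)) y := hΓ.comp y h1
  have h4 : ContDiffAt ℝ ∞ (fun y : (V × V) × ℝ => fderiv ℝ Γ (y.1.1, y.2)) y :=
    (hΓ.fderiv_right (m := ∞) (by simp)).comp y h1
  exact (h3.prodMk (h4.clm_apply h2)).prodMk contDiffAt_const

theorem fderiv_jet {Γ : V × ℝ → V} {y : (V × V) × ℝ} (hΓ : ContDiffAt ℝ ∞ Γ (y.1.1, y.2))
    (w : (V × V) × ℝ) : fderiv ℝ (jet Γ) y w =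
      ((fderiv ℝ Γ (y.1.1, y.2) (w.1.1, w.2),
        fderiv ℝ (fderiv ℝ Γ) (y.1.1, y.2) (w.1.1, w.2) (y.1.2, 1) +
          fderiv ℝ Γ (y.1.1, y.2) (w.1.2, 0)), 0) := by
  let A : (V × V) × ℝ →L[ℝ] V × ℝ :=
    ((ContinuousLinearMap.fst ℝ V V).comp (ContinuousLinearMap.fst ℝ (V × V) ℝ)).prod
      (ContinuousLinearMap.snd ℝ (V × V) ℝ)
  let B : (V × V) × ℝ →L[ℝ] V × ℝ :=
    ((ContinuousLinearMap.snd ℝ V V).comp (ContinuousLinearMap.fst ℝ (V × V) ℝ)).prod 0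
  have hA : HasFDerivAt A A y := A.hasFDerivAt
  have hB : HasFDerivAt (fun y : (V × V) × ℝ => (y.1.2, (1 : ℝ))) B y := by
    have h := B.hasFDerivAt.add_const (x := y) ((0, 1) : V × ℝ)
    convert! h using 1
    funext z
    simp [B]
  have h1 : HasFDerivAt Γ (fderiv ℝ Γ (A y)) (A y) :=
    (hΓ.differentiableAt (by simp)).hasFDerivAt
  have h2 : HasFDerivAt (fderiv ℝ Γ) (fderiv ℝ (fderiv ℝ Γ) (A y)) (A y) :=
    ((hΓ.fderiv_right (m := ∞) (by simp)).differentiableAt (by simp)).hasFDerivAt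
  have h3 := (h1.comp y hA).prodMk ((h2.comp y hA).clm_apply hB)
  have h4 := h3.prodMk (hasFDerivAt_const (1 : ℝ) y)
  have h5 : fderiv ℝ (jet Γ) y = _ := h4.fderiv
  rw [h5]
  simp [A, B, add_comm]

theorem fderiv_cartan_apply {L : (V × V) × ℝ → ℝ} {y : (V × V) × ℝ} (hL : ContDiffAt ℝ ∞ L y)
    (w u : (V × V) × ℝ) : fderiv ℝ (fun z => cartan L z w) y u =
      fderiv ℝ (fderiv ℝ L) y u ((0, w.1.1 - w.2 • y.1.2), 0) +
        fderiv ℝ L y ((0, -(w.2 • u.1.2)), 0) + fderiv ℝ L y u * w.2 := by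
  have hdL : HasFDerivAt L (fderiv ℝ L y) y := (hL.differentiableAt (by simp)).hasFDerivAt
  have hP : HasFDerivAt (fderiv ℝ L) (fderiv ℝ (fderiv ℝ L) y) y :=
    ((hL.fderiv_right (m := ∞) (by simp)).differentiableAt (by simp)).hasFDerivAt
  let A : (V × V) × ℝ →L[ℝ] (V × V) × ℝ :=
    (ContinuousLinearMap.inl ℝ (V × V) ℝ).comp ((ContinuousLinearMap.inr ℝ V V).comp
      ((-w.2) • ((ContinuousLinearMap.snd ℝ V V).comp (ContinuousLinearMap.fst ℝ (V × V) ℝ))))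
  have hA : HasFDerivAt (fun z : (V × V) × ℝ =>
      (((0 : V), w.1.1 - w.2 • z.1.2), (0 : ℝ))) A y := by
    have h := A.hasFDerivAt.const_add (x := y) (((0 : V), w.1.1), (0 : ℝ))
    convert! h using 1
    funext z
    simp [A, sub_eq_add_neg]
  have h := ((hP.clm_apply hA).add (hdL.mul_const w.2)).fderiv
  have h' : fderiv ℝ (fun z => cartan L z w) y = _ := h
  have hAu : A u = ((0, -(w.2 • u.1.2)), 0) := by simp [A]
  rw [h', ← hAu]
  change fderiv ℝ L y (A u) + fderiv ℝ (fderiv ℝ L) y u _ + w.2 * fderiv ℝ L y u = _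
  ring

/-- If the Hessian of `L` in the velocities is nondegenerate, then `dΘ_L` is nondegenerate on the
hyperplane `dt = 0`. -/
theorem eq_zero_of_fderiv_cartan {L : (V × V) × ℝ → ℝ} {y : (V × V) × ℝ}
    (hL : ContDiffAt ℝ ∞ L y)
    (hreg : ∀ a, (∀ b, fderiv ℝ (fderiv ℝ L) y ((0, b), 0) ((0, a), 0) = 0) → a = 0)
    {w : (V × V) × ℝ} (hw : w.2 = 0)
    (h : ∀ u : (V × V) × ℝ, u.2 = 0 →
      fderiv ℝ (fun z => cartan L z u) y w - fderiv ℝ (fun z => cartan L z w) y u = 0) :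
    w = 0 := by
  have hS : IsSymmSndFDerivAt ℝ L y := hL.isSymmSndFDerivAt DiffForm.minSmoothness_two_le
  have e6 : (((0 : V), (0 : V)), (0 : ℝ)) = 0 := rfl
  -- Vertical vectors `u` detect the `q`-component of `w`, then horizontal ones its `v`-component.
  have h1 : w.1.1 = 0 := hreg _ fun b => by
    have := h ((0, b), 0) rfl
    rw [fderiv_cartan_apply hL, fderiv_cartan_apply hL, hw] at this
    simpa [e6] using this
  have hw' : w = ((0, w.1.2), 0) := by
    rw [← hw, ← h1]
  have h2 : w.1.2 = 0 := hreg _ fun b => by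
    have := h ((b, 0), 0) rfl
    rw [fderiv_cartan_apply hL, fderiv_cartan_apply hL, hw, h1] at this
    rw [hS.eq, ← hw']
    simpa [e6] using this
  rw [hw', h2]
  rfl

/-- The infinitesimal symmetry identity: if `j(L) = 0` near `y`, then `i(j) dΘ_L = dE` at `y`, where
`E = -Θ_L(j)`. -/
theorem fderiv_cartan_jet {L : (V × V) × ℝ → ℝ} {Γ : V × ℝ → V} {y : (V × V) × ℝ}
    (hL : ContDiffAt ℝ ∞ L y) (hΓ : ContDiffAt ℝ ∞ Γ (y.1.1, y.2))
    (hsymm : ∀ᶠ z in 𝓝 y, fderiv ℝ L z (jet Γ z) = 0) (w : (V × V) × ℝ) :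
    fderiv ℝ (fun z => cartan L z w) y (jet Γ y) - fderiv ℝ (fun z => cartan L z (jet Γ y)) y w =
      fderiv ℝ (fun z => -cartan L z (jet Γ z)) y w := by
  have hP : HasFDerivAt (fderiv ℝ L) (fderiv ℝ (fderiv ℝ L) y) y :=
    ((hL.fderiv_right (m := ∞) (by simp)).differentiableAt (by simp)).hasFDerivAt
  have hS : IsSymmSndFDerivAt ℝ L y := hL.isSymmSndFDerivAt DiffForm.minSmoothness_two_le
  have hθ : HasFDerivAt (cartan L) (fderiv ℝ (cartan L) y) y :=
    ((contDiffAt_cartan hL).differentiableAt (by simp)).hasFDerivAt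
  have hj : HasFDerivAt (jet Γ) (fderiv ℝ (jet Γ) y) y :=
    ((contDiffAt_jet hΓ).differentiableAt (by simp)).hasFDerivAt
  set P := fderiv ℝ L y
  set P' := fderiv ℝ (fderiv ℝ L) y
  set j₀ := jet Γ y
  have hj₀ : P j₀ = 0 := hsymm.self_of_nhds
  -- the derivative of the symmetry condition
  have e1 : ∀ u, P' u j₀ + P (fderiv ℝ (jet Γ) y u) = 0 := by
    intro u
    have h1 := hP.clm_apply hj
    have h2 : (fun z => fderiv ℝ L z (jet Γ z)) =ᶠ[𝓝 y] fun _ => 0 := hsymm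
    have h3 := h1.fderiv
    rw [h2.fderiv_eq] at h3
    have h4 := DFunLike.congr_fun h3 u
    simpa [add_comm] using h4.symm
  have e2 : ∀ u, fderiv ℝ (fun z => cartan L z u) y = (fderiv ℝ (cartan L) y).flip u := by
    intro u
    have h := (hθ.clm_apply (hasFDerivAt_const u y)).fderiv
    rw [h]
    refine ContinuousLinearMap.ext fun x => ?_
    simp
  have e3 : fderiv ℝ (fun z => -cartan L z (jet Γ z)) y w =
      -(fderiv ℝ (cartan L) y w j₀ + cartan L y (fderiv ℝ (jet Γ) y w)) := by
    have h := (hθ.clm_apply hj).neg.fderiv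
    have h' : fderiv ℝ (fun z => -cartan L z (jet Γ z)) y = _ := h
    rw [h']
    simp [j₀, add_comm]
  have e4 := fderiv_cartan_apply hL w j₀
  rw [e3, e2 j₀, ContinuousLinearMap.flip_apply, e4, hj₀]
  -- The symmetry condition, differentiated along the vertical vector `𝒱(w)`.
  have e5 := e1 ((0, w.1.1 - w.2 • y.1.2), 0)
  rw [hS.eq] at e5
  rw [fderiv_jet hΓ] at e5 ⊢
  rw [cartan_apply]
  have e6 : ((0 : V), (0 : ℝ)) = 0 := rfl
  simp only [e6, map_zero, zero_apply, zero_add] at e5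
  have e7 : j₀.1.2 = fderiv ℝ Γ (y.1.1, y.2) (y.1.2, 1) := rfl
  rw [e7]
  set DΓ := fderiv ℝ Γ (y.1.1, y.2)
  let ι : V →L[ℝ] ℝ := P.comp ((ContinuousLinearMap.inl ℝ (V × V) ℝ).comp
    (ContinuousLinearMap.inr ℝ V V))
  have hι : ∀ b, P ((0, b), 0) = ι b := fun b => rfl
  rw [hι] at e5
  rw [hι, hι]
  have e8 : DΓ (w.1.1 - w.2 • y.1.2, 0) = DΓ (w.1.1, w.2) - w.2 • DΓ (y.1.2, 1) := by
    rw [← map_smul, ← map_sub]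
    congr 1
    ext <;> simp
  rw [e8, map_sub, map_smul] at e5
  simp only [map_neg, map_smul, zero_smul, sub_zero, mul_zero, add_zero, zero_mul]
  linear_combination e5

end TimeDependent.Coord

/-! ### Natural charts of the tangent bundle -/

namespace DiffForm

variable {E : Type*} [NormedAddCommGroup E] [NormedSpace ℝ E]
  {H : Type*} [TopologicalSpace H] {I : ModelWithCorners ℝ E H} [I.Boundaryless]
  {M : Type*} [TopologicalSpace M] [ChartedSpace H M] [IsManifold I ∞ M]

theorem mem_tangentChart_target {p : TangentBundle I M} {z : E × E} :
    z ∈ (extChartAt I.tangent p).target ↔ z.1 ∈ (extChartAt I p.proj).target := by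
  rw [FiberBundle.extChartAt_target]
  constructor
  · exact fun h => h.1.1
  · refine fun h => ⟨⟨h, ?_⟩, trivial⟩
    have h' := (extChartAt I p.proj).map_target h
    rw [extChartAt_source] at h'
    simpa using h'

theorem mem_tangentChart_source {p z : TangentBundle I M} :
    z ∈ (extChartAt I.tangent p).source ↔ z.proj ∈ (extChartAt I p.proj).source := by
  rw [extChartAt_source, extChartAt_source, TangentBundle.mem_chart_source_iff]

theorem tangentChart_apply {p z : TangentBundle I M} (hz : z.proj ∈ (extChartAt I p.proj).source) :
    extChartAt I.tangent p z =
      (extChartAt I p.proj z.proj, mfderiv I 𝓘(ℝ, E) (extChartAt I p.proj) z.proj z.snd) := by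
  have hz' : z.proj ∈ (chartAt H p.proj).source := by rwa [← extChartAt_source (I := I)]
  have h2 := TangentBundle.continuousLinearMapAt_trivializationAt (I := I) hz'
  have h3 : (trivializationAt E (TangentSpace I) p.proj z).2 =
      (trivializationAt E (TangentSpace I) p.proj).continuousLinearMapAt ℝ z.proj z.snd := by
    rw [Bundle.Trivialization.continuousLinearMapAt_apply,
      Bundle.Trivialization.linearMapAt_apply, if_pos (by simpa using hz')]
  have h4 : extChartAt I.tangent p z = (extChartAt I p.proj z.proj,
      (trivializationAt E (TangentSpace I) p.proj z).2) := by
    rw [FiberBundle.extChartAt]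
    change (extChartAt I p.proj (trivializationAt E (TangentSpace I) p.proj z).1, _) = _
    rw [TangentBundle.trivializationAt_fst]
    rfl
  rw [h4, h3, h2]
  rfl

theorem tangentChart_symm_apply {p : TangentBundle I M} {q : E}
    (hq : q ∈ (extChartAt I p.proj).target) (v : E) :
    (extChartAt I.tangent p).symm (q, v) = (⟨(extChartAt I p.proj).symm q,
      mfderiv 𝓘(ℝ, E) I (extChartAt I p.proj).symm q v⟩ : TangentBundle I M) := by
  set z : TangentBundle I M := ⟨(extChartAt I p.proj).symm q,
      mfderiv 𝓘(ℝ, E) I (extChartAt I p.proj).symm q v⟩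
  have hz : z.proj ∈ (extChartAt I p.proj).source := (extChartAt I p.proj).map_target hq
  have h1 := tangentChart_apply hz
  have h2 : extChartAt I.tangent p z = (q, v) := by
    rw [h1]
    refine Prod.ext ((extChartAt I p.proj).right_inv hq) ?_
    exact mfderiv_extChartAt_mfderiv_extChartAt_symm hq v
  rw [← h2, (extChartAt I.tangent p).left_inv (mem_tangentChart_source.2 hz)]

/-- The tangent space at a point is read in the chart at that same point. -/
theorem mfderiv_eq_fderiv_chart {G : Type*} [NormedAddCommGroup G] [NormedSpace ℝ G] {ξ : G → M}
    {y : G} (hξ : MDifferentiableAt 𝓘(ℝ, G) I ξ y) :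
    (mfderiv 𝓘(ℝ, G) I ξ y : G →L[ℝ] E) = fderiv ℝ (extChartAt I (ξ y) ∘ ξ) y := by
  have h := mfderiv_comp y
    ((contMDiffAt_extChartAt (I := I) (n := ∞) (x := ξ y)).mdifferentiableAt (by simp)) hξ
  rw [mfderiv_extChartAt_self, mfderiv_eq_fderiv] at h
  exact h.symm

/-- The differential of a natural parametrization of `TM`, whose transition maps are
`(x, w) ↦ (g x, Dg_x w)`. -/
theorem mfderiv_tangentChart_symm {p : TangentBundle I M} {q : E}
    (hq : q ∈ (extChartAt I p.proj).target) {g : E → E}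
    (hgdef : g = extChartAt I ((extChartAt I p.proj).symm q) ∘ (extChartAt I p.proj).symm)
    (u a b : E) :
    (mfderiv 𝓘(ℝ, E × E) I.tangent (extChartAt I.tangent p).symm (q, u) (a, b) : E × E) =
      (fderiv ℝ g q a, fderiv ℝ (fderiv ℝ g) q a u + fderiv ℝ g q b) := by
  subst hgdef
  set ψ := extChartAt I p.proj
  set P : TangentBundle I M := (extChartAt I.tangent p).symm (q, u)
  have hP : P = (⟨ψ.symm q, mfderiv 𝓘(ℝ, E) I ψ.symm q u⟩ : TangentBundle I M) :=
    tangentChart_symm_apply hq u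
  have hPp : P.proj = ψ.symm q := by rw [hP]
  set ψ' := extChartAt I (ψ.symm q)
  set g := ψ' ∘ ψ.symm
  have hψ : ContMDiffAt 𝓘(ℝ, E) I ∞ ψ.symm q := contMDiffAt_extChartAt_symm hq
  have hg : ContDiffAt ℝ ∞ g q :=
    (ContMDiffAt.comp q (contMDiffAt_extChartAt (I := I) (x := ψ.symm q)) hψ).contDiffAt
  have hmem : (q, u) ∈ (extChartAt I.tangent p).target := mem_tangentChart_target.2 hq
  have h1 := mfderiv_eq_fderiv_chart (I := I.tangent) (M := TangentBundle I M)
    ((contMDiffAt_extChartAt_symm (I := I.tangent) hmem).mdifferentiableAt (by simp))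
  have h3 : extChartAt I.tangent P ∘ (extChartAt I.tangent p).symm =ᶠ[𝓝 (q, u)]
      fun z => (g z.1, fderiv ℝ g z.1 z.2) := by
    have e1 : ∀ᶠ x in 𝓝 q, x ∈ ψ.target := (isOpen_extChartAt_target p.proj).mem_nhds hq
    have e2 : ∀ᶠ x in 𝓝 q, ψ.symm x ∈ ψ'.source := hψ.continuousAt.eventually
      ((isOpen_extChartAt_source _).mem_nhds (mem_extChartAt_source _))
    have e3 : ∀ᶠ z : E × E in 𝓝 (q, u), z.1 ∈ ψ.target ∧ ψ.symm z.1 ∈ ψ'.source :=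
      (continuous_fst.tendsto (q, u)).eventually (e1.and e2)
    filter_upwards [e3] with z hz
    have hzd : MDifferentiableAt 𝓘(ℝ, E) I ψ.symm z.1 :=
      (contMDiffAt_extChartAt_symm hz.1).mdifferentiableAt (by simp)
    have hzd' : MDifferentiableAt I 𝓘(ℝ, E) ψ' (ψ.symm z.1) :=
      mdifferentiableAt_extChartAt (by
        have := hz.2
        rwa [extChartAt_source] at this)
    have e4 := tangentChart_symm_apply (p := p) (q := z.1) hz.1 z.2
    have e5 : (fderiv ℝ g z.1 z.2 : E) = mfderiv I 𝓘(ℝ, E) ψ' (ψ.symm z.1)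
        (mfderiv 𝓘(ℝ, E) I ψ.symm z.1 z.2) := mfderiv_extChartAt_symm_comp hz.1 hzd' z.2
    rw [Function.comp_apply, e4, tangentChart_apply (by rw [hPp]; exact hz.2), e5]
    rw [hPp]
    rfl
  have h4 : HasFDerivAt (fun z : E × E => (g z.1, fderiv ℝ g z.1 z.2))
      (((fderiv ℝ g q).comp (ContinuousLinearMap.fst ℝ E E)).prod
        ((fderiv ℝ g q).comp (ContinuousLinearMap.snd ℝ E E) +
          ((fderiv ℝ (fderiv ℝ g) q).comp (ContinuousLinearMap.fst ℝ E E)).flip u)) (q, u) := by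
    have f1 : HasFDerivAt g (fderiv ℝ g q) ((q, u) : E × E).1 :=
      (hg.differentiableAt (by simp)).hasFDerivAt
    have f2 : HasFDerivAt (fderiv ℝ g) (fderiv ℝ (fderiv ℝ g) q) ((q, u) : E × E).1 :=
      ((hg.fderiv_right (m := ∞) (by simp)).differentiableAt (by simp)).hasFDerivAt
    exact (f1.comp (q, u) hasFDerivAt_fst).prodMk
      ((f2.comp (q, u) hasFDerivAt_fst).clm_apply hasFDerivAt_snd)
  have h5 : (mfderiv 𝓘(ℝ, E × E) I.tangent (extChartAt I.tangent p).symm (q, u) (a, b) : E × E) =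
      fderiv ℝ (extChartAt I.tangent P ∘ (extChartAt I.tangent p).symm) (q, u) (a, b) :=
    DFunLike.congr_fun h1 (a, b)
  rw [h5, h3.fderiv_eq, h4.fderiv, add_comm]
  rfl

theorem mfderiv_tangentChart_symm_fst {p : TangentBundle I M} {q : E}
    (hq : q ∈ (extChartAt I p.proj).target) (u a b : E) :
    (mfderiv 𝓘(ℝ, E × E) I.tangent (extChartAt I.tangent p).symm (q, u) (a, b) : E × E).1 =
      mfderiv 𝓘(ℝ, E) I (extChartAt I p.proj).symm q a := by
  rw [mfderiv_tangentChart_symm hq rfl]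
  exact (DFunLike.congr_fun (mfderiv_eq_fderiv_chart
    ((contMDiffAt_extChartAt_symm hq).mdifferentiableAt (by simp))) a).symm

/-- The canonical flip of `TTM`: the fibre component of `T(TM)` is symmetric in the two tangent
vectors. -/
theorem mfderiv_tangentChart_symm_flip {p : TangentBundle I M} {q : E}
    (hq : q ∈ (extChartAt I p.proj).target) (u a b : E) :
    (mfderiv 𝓘(ℝ, E × E) I.tangent (extChartAt I.tangent p).symm (q, u) (a, b) : E × E).2 =
      (mfderiv 𝓘(ℝ, E × E) I.tangent (extChartAt I.tangent p).symm (q, a) (u, b) : E × E).2 := by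
  rw [mfderiv_tangentChart_symm hq rfl, mfderiv_tangentChart_symm hq rfl]
  have hg : ContDiffAt ℝ ∞ (extChartAt I ((extChartAt I p.proj).symm q) ∘
      (extChartAt I p.proj).symm) q :=
    (ContMDiffAt.comp q (contMDiffAt_extChartAt (I := I) (x := (extChartAt I p.proj).symm q))
      (contMDiffAt_extChartAt_symm hq)).contDiffAt
  rw [(hg.isSymmSndFDerivAt minSmoothness_two_le).eq a u]

end DiffForm

/-! ### Time-dependent Lagrangian systems in natural charts -/

namespace TimeDependent

open DiffForm

variable {n : ℕ} {Q : Type*} [TopologicalSpace Q] [ChartedSpace (EuclideanSpace ℝ (Fin n)) Q]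
  [IsManifold (𝓡 n) ∞ Q]

local notation "𝕍" => EuclideanSpace ℝ (Fin n)

theorem mem_phaseChart_target {p₀ : Phase n Q} {y : (𝕍 × 𝕍) × ℝ} :
    y ∈ (extChartAt (phaseModel n) p₀).target ↔
      y.1.1 ∈ (extChartAt (𝓡 n) p₀.1.proj).target := by
  rw [extChartAt_prod, PartialEquiv.prod_target, extChartAt_model_space_eq_id]
  rw [← mem_tangentChart_target (I := 𝓡 n)]
  simp

theorem phaseChart_symm (p₀ : Phase n Q) :
    ((extChartAt (phaseModel n) p₀).symm : (𝕍 × 𝕍) × ℝ → Phase n Q) =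
      Prod.map (extChartAt (𝓡 n).tangent p₀.1).symm id := by
  rw [extChartAt_prod, extChartAt_model_space_eq_id]
  rfl

/-- The point of `TQ × ℝ` with natural coordinates `y = ((q, v), t)` in the chart of `Q` at `x₀`. -/
def chartPoint (x₀ : Q) (y : (𝕍 × 𝕍) × ℝ) : Phase n Q :=
  (⟨(extChartAt (𝓡 n) x₀).symm y.1.1,
    mfderiv 𝓘(ℝ, 𝕍) (𝓡 n) (extChartAt (𝓡 n) x₀).symm y.1.1 y.1.2⟩, y.2)

theorem phaseChart_symm_apply {p₀ : Phase n Q} {y : (𝕍 × 𝕍) × ℝ}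
    (hy : y ∈ (extChartAt (phaseModel n) p₀).target) :
    (extChartAt (phaseModel n) p₀).symm y = chartPoint p₀.1.proj y := by
  rw [phaseChart_symm]
  have h := tangentChart_symm_apply (I := 𝓡 n) (p := p₀.1) (mem_phaseChart_target.1 hy) y.1.2
  exact Prod.ext h rfl

theorem mfderiv_phaseChart_symm {p₀ : Phase n Q} {y : (𝕍 × 𝕍) × ℝ}
    (hy : y ∈ (extChartAt (phaseModel n) p₀).target)
    (w : (𝕍 × 𝕍) × ℝ) :
    (mfderiv 𝓘(ℝ, (𝕍 × 𝕍) × ℝ) (phaseModel n) (extChartAt (phaseModel n) p₀).symm y w :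
      (𝕍 × 𝕍) × ℝ) =
      (mfderiv 𝓘(ℝ, 𝕍 × 𝕍) (𝓡 n).tangent (extChartAt (𝓡 n).tangent p₀.1).symm y.1 w.1, w.2) := by
  have h1 : MDifferentiableAt 𝓘(ℝ, 𝕍 × 𝕍) (𝓡 n).tangent
      (extChartAt (𝓡 n).tangent p₀.1).symm y.1 :=
    (contMDiffAt_extChartAt_symm (mem_tangentChart_target.2
      (mem_phaseChart_target.1 hy))).mdifferentiableAt (by simp)
  have h2 : MDifferentiableAt 𝓘(ℝ, ℝ) 𝓘(ℝ, ℝ) (id : ℝ → ℝ) y.2 := mdifferentiableAt_id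
  have h3 := mfderiv_prodMap h1 h2
  rw [← phaseChart_symm, mfderiv_id, ← modelWithCornersSelf_prod, chartedSpaceSelf_prod] at h3
  exact DFunLike.congr_fun h3 w

theorem dt_apply (p : Phase n Q) (w : TangentSpace (phaseModel n) p) :
    dt p w = (show (𝕍 × 𝕍) × ℝ from w).2 := by
  have h : dt p = ContinuousLinearMap.snd ℝ (TangentSpace (𝓡 n).tangent p.1)
      (TangentSpace 𝓘(ℝ, ℝ) p.2) := mfderiv_snd
  rw [h]
  rfl

theorem dt_mfderiv_phaseChart_symm {p₀ : Phase n Q} {y : (𝕍 × 𝕍) × ℝ}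
    (hy : y ∈ (extChartAt (phaseModel n) p₀).target)
    (w : (𝕍 × 𝕍) × ℝ) :
    dt ((extChartAt (phaseModel n) p₀).symm y)
      (mfderiv 𝓘(ℝ, (𝕍 × 𝕍) × ℝ) (phaseModel n) (extChartAt (phaseModel n) p₀).symm y w) =
        w.2 := by
  have h := congrArg (fun u : (𝕍 × 𝕍) × ℝ => u.2) (mfderiv_phaseChart_symm hy w)
  exact (dt_apply _ _).trans h

theorem mfderiv_phaseProj {p₀ : Phase n Q} {y : (𝕍 × 𝕍) × ℝ}
    (hy : y ∈ (extChartAt (phaseModel n) p₀).target) (w : (𝕍 × 𝕍) × ℝ) :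
    (mfderiv (phaseModel n) (𝓡 n) (fun p : Phase n Q => p.1.proj)
      ((extChartAt (phaseModel n) p₀).symm y)
      (mfderiv 𝓘(ℝ, (𝕍 × 𝕍) × ℝ) (phaseModel n) (extChartAt (phaseModel n) p₀).symm y w) : 𝕍) =
      mfderiv 𝓘(ℝ, 𝕍) (𝓡 n) (extChartAt (𝓡 n) p₀.1.proj).symm y.1.1 w.1.1 := by
  set ψ := extChartAt (𝓡 n) p₀.1.proj
  have h1 : MDifferentiableAt (phaseModel n) (𝓡 n) (fun p : Phase n Q => p.1.proj)
      ((extChartAt (phaseModel n) p₀).symm y) :=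
    (((Bundle.contMDiff_proj (n := ∞) (IB := 𝓡 n) (TangentSpace (𝓡 n) : Q → Type _)).comp
      contMDiff_fst).contMDiffAt).mdifferentiableAt (by simp)
  have h2 := mfderiv_comp y h1 ((contMDiffAt_extChartAt_symm hy).mdifferentiableAt (by simp))
  have h3 : (fun p : Phase n Q => p.1.proj) ∘ (extChartAt (phaseModel n) p₀).symm =ᶠ[𝓝 y]
      ψ.symm ∘ fun z : (𝕍 × 𝕍) × ℝ => z.1.1 := by
    filter_upwards [(isOpen_extChartAt_target p₀).mem_nhds hy] with z hz
    rw [Function.comp_apply, phaseChart_symm_apply hz]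
    rfl
  have h4 : HasFDerivAt (fun z : (𝕍 × 𝕍) × ℝ => z.1.1)
      ((ContinuousLinearMap.fst ℝ 𝕍 𝕍).comp (ContinuousLinearMap.fst ℝ (𝕍 × 𝕍) ℝ)) y :=
    ((ContinuousLinearMap.fst ℝ 𝕍 𝕍).comp (ContinuousLinearMap.fst ℝ (𝕍 × 𝕍) ℝ)).hasFDerivAt
  have h5 : MDifferentiableAt 𝓘(ℝ, 𝕍) (𝓡 n) ψ.symm y.1.1 :=
    (contMDiffAt_extChartAt_symm (mem_phaseChart_target.1 hy)).mdifferentiableAt (by simp)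
  have h6 := mfderiv_comp y (f := fun z : (𝕍 × 𝕍) × ℝ => z.1.1) h5
    h4.differentiableAt.mdifferentiableAt
  rw [mfderiv_eq_fderiv, h4.fderiv] at h6
  have h7 := h3.mfderiv_eq (I := 𝓘(ℝ, (𝕍 × 𝕍) × ℝ)) (I' := 𝓡 n)
  have h8 := DFunLike.congr_fun h2 w
  have h9 := DFunLike.congr_fun h6 w
  have h10 : (mfderiv 𝓘(ℝ, (𝕍 × 𝕍) × ℝ) (𝓡 n) ((fun p : Phase n Q => p.1.proj) ∘
      (extChartAt (phaseModel n) p₀).symm) y w : 𝕍) =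
      mfderiv 𝓘(ℝ, (𝕍 × 𝕍) × ℝ) (𝓡 n) (ψ.symm ∘ fun z : (𝕍 × 𝕍) × ℝ => z.1.1) y w :=
    DFunLike.congr_fun h7 w
  exact h8.symm.trans (h10.trans h9)

/-- In a natural chart the vertical lift of `δq^μ ∂/∂q^μ` is `δq^μ ∂/∂v^μ`. -/
theorem verticalLift_apply {p₀ : Phase n Q} {q v : 𝕍} {t : ℝ} (hq : q ∈ (extChartAt (𝓡 n) p₀.1.proj).target)
    (b : 𝕍) :
    (verticalLift (chartPoint p₀.1.proj ((q, v), t))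
      (mfderiv 𝓘(ℝ, 𝕍) (𝓡 n) (extChartAt (𝓡 n) p₀.1.proj).symm q b) : (𝕍 × 𝕍) × ℝ) =
      mfderiv 𝓘(ℝ, (𝕍 × 𝕍) × ℝ) (phaseModel n) (extChartAt (phaseModel n) p₀).symm ((q, v), t)
        ((0, b), 0) := by
  set ψ := extChartAt (𝓡 n) p₀.1.proj
  set φ := extChartAt (phaseModel n) p₀
  let τ : 𝕍 →L[ℝ] 𝕍 := mfderiv 𝓘(ℝ, 𝕍) (𝓡 n) ψ.symm q
  let τ' : 𝕍 →L[ℝ] 𝕍 := mfderiv (𝓡 n) 𝓘(ℝ, 𝕍) ψ (ψ.symm q)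
  have hττ' : ∀ u, τ (τ' u) = u := fun u =>
    mfderiv_extChartAt_symm_mfderiv_extChartAt (I := 𝓡 n) (x₀ := p₀.1.proj) hq u
  have hτ'τ : ∀ u, τ' (τ u) = u := fun u =>
    mfderiv_extChartAt_mfderiv_extChartAt_symm (I := 𝓡 n) (x₀ := p₀.1.proj) hq u
  have htgt : ∀ u, ((q, u), t) ∈ φ.target := fun u => mem_phaseChart_target.2 hq
  have h1 : (fun u : 𝕍 => ((⟨ψ.symm q, u⟩, t) : Phase n Q)) = φ.symm ∘ fun u => ((q, τ' u), t) := by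
    funext u
    rw [Function.comp_apply, phaseChart_symm_apply (htgt _)]
    exact congrArg (fun u : 𝕍 => ((⟨ψ.symm q, u⟩, t) : Phase n Q)) (hττ' u).symm
  have h2 : HasFDerivAt (fun u : 𝕍 => ((q, τ' u), t))
      (((0 : 𝕍 →L[ℝ] 𝕍).prod τ').prod (0 : 𝕍 →L[ℝ] ℝ)) (τ v) :=
    ((hasFDerivAt_const q _).prodMk τ'.hasFDerivAt).prodMk (hasFDerivAt_const t _)
  have h3 : MDifferentiableAt 𝓘(ℝ, (𝕍 × 𝕍) × ℝ) (phaseModel n) φ.symm ((q, τ' (τ v)), t) :=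
    (contMDiffAt_extChartAt_symm (htgt _)).mdifferentiableAt (by simp)
  have h4 := mfderiv_comp (τ v) (f := fun u : 𝕍 => ((q, τ' u), t)) h3
    h2.differentiableAt.mdifferentiableAt
  rw [mfderiv_eq_fderiv, h2.fderiv, ← h1] at h4
  have h5 := DFunLike.congr_fun h4 (τ b)
  have h6 : (mfderiv 𝓘(ℝ, (𝕍 × 𝕍) × ℝ) (phaseModel n) φ.symm ((q, τ' (τ v)), t)
      ((0, τ' (τ b)), 0) : (𝕍 × 𝕍) × ℝ) =
      mfderiv 𝓘(ℝ, (𝕍 × 𝕍) × ℝ) (phaseModel n) φ.symm ((q, v), t) ((0, b), 0) := by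
    rw [hτ'τ, hτ'τ]
  exact h5.trans h6

/-- The Poincaré-Cartan form in a natural chart. -/
theorem cartanOne_mfderiv_phaseChart_symm {L : Phase n Q → ℝ} {p₀ : Phase n Q}
    {y : (𝕍 × 𝕍) × ℝ}
    (hL : ContMDiff (phaseModel n) 𝓘(ℝ, ℝ) ∞ L)
    (hy : y ∈ (extChartAt (phaseModel n) p₀).target) (w : (𝕍 × 𝕍) × ℝ) :
    cartanOne L ((extChartAt (phaseModel n) p₀).symm y)
      (mfderiv 𝓘(ℝ, (𝕍 × 𝕍) × ℝ) (phaseModel n) (extChartAt (phaseModel n) p₀).symm y w) =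
      Coord.cartan (L ∘ (extChartAt (phaseModel n) p₀).symm) y w := by
  have hy' := mem_phaseChart_target.1 hy
  set ψ := extChartAt (𝓡 n) p₀.1.proj
  set φ := extChartAt (phaseModel n) p₀
  let D : (𝕍 × 𝕍) × ℝ →L[ℝ] (𝕍 × 𝕍) × ℝ :=
    mfderiv 𝓘(ℝ, (𝕍 × 𝕍) × ℝ) (phaseModel n) φ.symm y
  let τ : 𝕍 →L[ℝ] 𝕍 := mfderiv 𝓘(ℝ, 𝕍) (𝓡 n) ψ.symm y.1.1
  set P : Phase n Q := chartPoint p₀.1.proj y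
  have hP : φ.symm y = P := phaseChart_symm_apply hy
  have hvert : (verticalEndo P (D w) : (𝕍 × 𝕍) × ℝ) = D ((0, w.1.1 - w.2 • y.1.2), 0) := by
    have h1 : (structureForm P (D w) : 𝕍) = τ (w.1.1 - w.2 • y.1.2) := by
      have h2 : (mfderiv (phaseModel n) (𝓡 n) (fun p : Phase n Q => p.1.proj) P (D w) : 𝕍) =
          τ w.1.1 := by
        rw [← hP]
        exact mfderiv_phaseProj hy w
      have h3 : dt P (D w) = w.2 := by
        rw [← hP]
        exact dt_mfderiv_phaseChart_symm hy w
      rw [map_sub, map_smul, ← h2]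
      change _ - dt P (D w) • τ y.1.2 = _
      rw [h3]
      rfl
    refine Eq.trans ?_ (verticalLift_apply (t := y.2) (v := y.1.2) hy' (w.1.1 - w.2 • y.1.2))
    change (verticalLift P (structureForm P (D w)) : (𝕍 × 𝕍) × ℝ) = _
    rw [h1]
    rfl
  have hd : dFun L (φ.symm y) (D ((0, w.1.1 - w.2 • y.1.2), 0)) =
      fderiv ℝ (L ∘ φ.symm) y ((0, w.1.1 - w.2 • y.1.2), 0) :=
    (mfderiv_extChartAt_symm_comp hy ((hL _).mdifferentiableAt (by simp)) _).symm
  have h5 : dFun L (φ.symm y) (verticalEndo (φ.symm y) (D w)) =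
      dFun L (φ.symm y) (D ((0, w.1.1 - w.2 • y.1.2), 0)) := by
    rw [hP]
    exact congrArg _ hvert
  have h6 := dt_mfderiv_phaseChart_symm hy w
  rw [Coord.cartan_apply, ← hd, ← h5, ← h6]
  rfl

end TimeDependent

/-! ### The canonical lift of a connection in natural charts -/

namespace TimeDependent

open DiffForm

variable {n : ℕ} {Q : Type*} [TopologicalSpace Q] [ChartedSpace (EuclideanSpace ℝ (Fin n)) Q]
  [IsManifold (𝓡 n) ∞ Q]

local notation "𝕍" => EuclideanSpace ℝ (Fin n)

namespace Connection

variable (C : Connection n Q)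

/-- The components `Γ^μ(q, t)` of the connection in the chart of `Q` at `x₀`. -/
def components (x₀ : Q) (z : 𝕍 × ℝ) : 𝕍 :=
  mfderiv (𝓡 n) 𝓘(ℝ, 𝕍) (extChartAt (𝓡 n) x₀) ((extChartAt (𝓡 n) x₀).symm z.1)
    (C.Y ((extChartAt (𝓡 n) x₀).symm z.1, z.2))

theorem mfderiv_extChartAt_symm_components {x₀ : Q} {z : 𝕍 × ℝ}
    (hz : z.1 ∈ (extChartAt (𝓡 n) x₀).target) :
    (mfderiv 𝓘(ℝ, 𝕍) (𝓡 n) (extChartAt (𝓡 n) x₀).symm z.1 (C.components x₀ z) : 𝕍) =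
      C.Y ((extChartAt (𝓡 n) x₀).symm z.1, z.2) :=
  mfderiv_extChartAt_symm_mfderiv_extChartAt hz _

/-- In a natural chart the section `(q, t) ↦ Y(q, t)` is `(q, t) ↦ (q, Γ(q, t))`. -/
theorem lift_extChartAt_symm {p : TangentBundle (𝓡 n) Q} {z : 𝕍 × ℝ}
    (hz : z.1 ∈ (extChartAt (𝓡 n) p.proj).target) :
    C.lift ((extChartAt (𝓡 n) p.proj).symm z.1, z.2) =
      (extChartAt (𝓡 n).tangent p).symm (z.1, C.components p.proj z) := by
  rw [tangentChart_symm_apply hz]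
  exact congrArg (fun u : 𝕍 =>
    (⟨(extChartAt (𝓡 n) p.proj).symm z.1, u⟩ : TangentBundle (𝓡 n) Q))
    (C.mfderiv_extChartAt_symm_components hz).symm

theorem contDiffAt_components (x₀ : Q) {z : 𝕍 × ℝ} (hz : z.1 ∈ (extChartAt (𝓡 n) x₀).target) :
    ContDiffAt ℝ ∞ (C.components x₀) z := by
  let p : TangentBundle (𝓡 n) Q := ⟨x₀, 0⟩
  have h1 : ContMDiffAt 𝓘(ℝ, 𝕍 × ℝ) ((𝓡 n).prod 𝓘(ℝ, ℝ)) ∞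
      (fun z : 𝕍 × ℝ => ((extChartAt (𝓡 n) x₀).symm z.1, z.2)) z :=
    (ContMDiffAt.comp z (contMDiffAt_extChartAt_symm hz)
      contDiff_fst.contMDiff.contMDiffAt).prodMk contDiff_snd.contMDiff.contMDiffAt
  have h2 : ContMDiffAt 𝓘(ℝ, 𝕍 × ℝ) (𝓡 n).tangent ∞
      (fun z : 𝕍 × ℝ => C.lift ((extChartAt (𝓡 n) x₀).symm z.1, z.2)) z :=
    ContMDiffAt.comp z (C.smooth _) h1
  have hsrc : C.lift ((extChartAt (𝓡 n) x₀).symm z.1, z.2) ∈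
      (chartAt (ModelProd 𝕍 𝕍) p).source := by
    rw [← extChartAt_source (I := (𝓡 n).tangent), mem_tangentChart_source]
    exact (extChartAt (𝓡 n) x₀).map_target hz
  have h3 : ContMDiffAt 𝓘(ℝ, 𝕍 × ℝ) 𝓘(ℝ, 𝕍 × 𝕍) ∞ (fun z : 𝕍 × ℝ =>
      extChartAt (𝓡 n).tangent p (C.lift ((extChartAt (𝓡 n) x₀).symm z.1, z.2))) z :=
    ContMDiffAt.comp z (contMDiffAt_extChartAt' hsrc) h2
  refine (contDiff_snd.contDiffAt.comp z h3.contDiffAt).congr_of_eventuallyEq ?_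
  have h4 : ∀ᶠ z' : 𝕍 × ℝ in 𝓝 z, z'.1 ∈ (extChartAt (𝓡 n) x₀).target :=
    (continuous_fst.tendsto z).eventually ((isOpen_extChartAt_target x₀).mem_nhds hz)
  filter_upwards [h4] with z' hz'
  rw [Function.comp_apply, tangentChart_apply (by exact (extChartAt (𝓡 n) x₀).map_target hz')]
  rfl

/-- In a natural chart the canonical lift is `∂/∂t + Γ^μ ∂/∂q^μ + (∂Γ^μ/∂t + v^ν ∂Γ^μ/∂q^ν) ∂/∂v^μ`.
The canonical flip makes the definition independent of the chart. -/
theorem jetLift_phaseChart_symm {p₀ : Phase n Q} {y : (𝕍 × 𝕍) × ℝ}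
    (hy : y ∈ (extChartAt (phaseModel n) p₀).target) :
    (C.jetLift ((extChartAt (phaseModel n) p₀).symm y) : (𝕍 × 𝕍) × ℝ) =
      mfderiv 𝓘(ℝ, (𝕍 × 𝕍) × ℝ) (phaseModel n) (extChartAt (phaseModel n) p₀).symm y
        (Coord.jet (C.components p₀.1.proj) y) := by
  have hq := mem_phaseChart_target.1 hy
  set Γ := C.components p₀.1.proj with hΓdef
  have hΓ : ContDiffAt ℝ ∞ Γ (y.1.1, y.2) := C.contDiffAt_components p₀.1.proj hq
  set ψ := extChartAt (𝓡 n) p₀.1.proj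
  set Ψ := extChartAt (𝓡 n).tangent p₀.1
  let τ : 𝕍 →L[ℝ] 𝕍 := mfderiv 𝓘(ℝ, 𝕍) (𝓡 n) ψ.symm y.1.1
  let D : (u : 𝕍 × 𝕍) → (𝕍 × 𝕍 →L[ℝ] 𝕍 × 𝕍) := fun u =>
    mfderiv 𝓘(ℝ, 𝕍 × 𝕍) (𝓡 n).tangent Ψ.symm u
  let A : 𝕍 × 𝕍 := mfderiv ((𝓡 n).prod 𝓘(ℝ, ℝ)) (𝓡 n).tangent C.lift (ψ.symm y.1.1, y.2)
    ((τ y.1.2, (1 : ℝ)) : 𝕍 × ℝ)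
  -- Differentiate the coordinate expression of `Y` along `(v, 1)`.
  have hA : A = D (y.1.1, Γ (y.1.1, y.2)) (y.1.2, fderiv ℝ Γ (y.1.1, y.2) (y.1.2, 1)) := by
    have e1 : C.lift ∘ Prod.map ψ.symm id =ᶠ[𝓝 (y.1.1, y.2)] Ψ.symm ∘ fun z => (z.1, Γ z) := by
      have h4 : ∀ᶠ z' : 𝕍 × ℝ in 𝓝 (y.1.1, y.2), z'.1 ∈ ψ.target :=
        (continuous_fst.tendsto (y.1.1, y.2)).eventually ((isOpen_extChartAt_target _).mem_nhds hq)
      filter_upwards [h4] with z hz using C.lift_extChartAt_symm hz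
    have d1 : MDifferentiableAt 𝓘(ℝ, 𝕍) (𝓡 n) ψ.symm y.1.1 :=
      (contMDiffAt_extChartAt_symm hq).mdifferentiableAt (by simp)
    have d2 : MDifferentiableAt 𝓘(ℝ, ℝ) 𝓘(ℝ, ℝ) (id : ℝ → ℝ) y.2 := mdifferentiableAt_id
    have d3 : MDifferentiableAt ((𝓡 n).prod 𝓘(ℝ, ℝ)) (𝓡 n).tangent C.lift
        (Prod.map ψ.symm id (y.1.1, y.2)) := (C.smooth _).mdifferentiableAt (by simp)
    have h3 := mfderiv_prodMap (p := (y.1.1, y.2)) d1 d2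
    have h3' := MDifferentiableAt.prodMap' (p := (y.1.1, y.2)) d1 d2
    rw [mfderiv_id] at h3
    rw [← modelWithCornersSelf_prod, chartedSpaceSelf_prod] at h3 h3'
    have h3'' : MDifferentiableAt 𝓘(ℝ, 𝕍 × ℝ) ((𝓡 n).prod 𝓘(ℝ, ℝ)) (Prod.map ψ.symm id)
        (y.1.1, y.2) := h3'
    have h4 := mfderiv_comp (y.1.1, y.2) d3 h3''
    have d4 : HasFDerivAt (fun z => (z.1, Γ z)) ((ContinuousLinearMap.fst ℝ 𝕍 ℝ).prod
        (fderiv ℝ Γ (y.1.1, y.2))) (y.1.1, y.2) :=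
      hasFDerivAt_fst.prodMk (hΓ.differentiableAt (by simp)).hasFDerivAt
    have d5 : MDifferentiableAt 𝓘(ℝ, 𝕍 × 𝕍) (𝓡 n).tangent Ψ.symm (y.1.1, Γ (y.1.1, y.2)) :=
      (contMDiffAt_extChartAt_symm
        (show (y.1.1, Γ (y.1.1, y.2)) ∈ Ψ.target from mem_tangentChart_target.2 hq)).mdifferentiableAt
        (by simp)
    have h5 := mfderiv_comp (y.1.1, y.2) (f := fun z => (z.1, Γ z)) d5
      d4.differentiableAt.mdifferentiableAt
    rw [mfderiv_eq_fderiv, d4.fderiv] at h5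
    have h6 : (mfderiv 𝓘(ℝ, 𝕍 × ℝ) (𝓡 n).tangent (C.lift ∘ Prod.map ψ.symm id) (y.1.1, y.2)
        (y.1.2, 1) : 𝕍 × 𝕍) = mfderiv 𝓘(ℝ, 𝕍 × ℝ) (𝓡 n).tangent (Ψ.symm ∘ fun z => (z.1, Γ z))
        (y.1.1, y.2) (y.1.2, 1) := DFunLike.congr_fun e1.mfderiv_eq (y.1.2, (1 : ℝ))
    have h7 := DFunLike.congr_fun h4 ((y.1.2, 1) : 𝕍 × ℝ)
    have h8 := DFunLike.congr_fun h5 ((y.1.2, 1) : 𝕍 × ℝ)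
    have h9 : (mfderiv 𝓘(ℝ, 𝕍 × ℝ) ((𝓡 n).prod 𝓘(ℝ, ℝ)) (Prod.map ψ.symm id) (y.1.1, y.2)
        (y.1.2, 1) : 𝕍 × ℝ) = (τ y.1.2, 1) := DFunLike.congr_fun h3 ((y.1.2, 1) : 𝕍 × ℝ)
    refine Eq.trans ?_ (h7.symm.trans (h6.trans h8))
    exact congrArg (fun u : 𝕍 × ℝ => (mfderiv ((𝓡 n).prod 𝓘(ℝ, ℝ)) (𝓡 n).tangent C.lift
      (ψ.symm y.1.1, y.2) u : 𝕍 × 𝕍)) h9.symm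
  have hjet : (C.jetLift (chartPoint p₀.1.proj y) : (𝕍 × 𝕍) × ℝ) =
      ((C.Y (ψ.symm y.1.1, y.2), A.2), 1) := rfl
  have hR := mfderiv_phaseChart_symm hy (Coord.jet Γ y)
  have h1 := mfderiv_tangentChart_symm_fst (p := p₀.1) hq y.1.2 (Coord.jet Γ y).1.1
    (Coord.jet Γ y).1.2
  have h2 := mfderiv_tangentChart_symm_flip (p := p₀.1) hq y.1.2 (Coord.jet Γ y).1.1
    (Coord.jet Γ y).1.2
  refine Eq.trans ?_ hR.symm
  have hL : (C.jetLift ((extChartAt (phaseModel n) p₀).symm y) : (𝕍 × 𝕍) × ℝ) =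
      C.jetLift (chartPoint p₀.1.proj y) := by
    rw [phaseChart_symm_apply hy]
  refine hL.trans (hjet.trans ?_)
  refine Prod.ext (Prod.ext ?_ ?_) rfl
  · exact (h1.trans (C.mfderiv_extChartAt_symm_components (z := (y.1.1, y.2)) hq)).symm
  · exact (congrArg Prod.snd hA).trans h2.symm

theorem contMDiff_jetLift : ContMDiff (phaseModel n) (phaseModel n).tangent ∞
    (fun p => (⟨p, C.jetLift p⟩ : TangentBundle (phaseModel n) (Phase n Q))) := by
  intro p
  have hp := mem_extChartAt_target (I := phaseModel n) p
  refine contMDiffAt_vectorField (V := Coord.jet (C.components p.1.proj)) ?_ fun y hy =>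
    C.jetLift_phaseChart_symm hy
  exact Coord.contDiffAt_jet (C.contDiffAt_components _ (mem_phaseChart_target.1 hp))

end Connection

end TimeDependent

/-! ### The Poincaré-Cartan forms and the energy -/

namespace DiffForm

variable {E : Type*} [NormedAddCommGroup E] [NormedSpace ℝ E]
  {H : Type*} [TopologicalSpace H] {I : ModelWithCorners ℝ E H} [I.Boundaryless]
  {M : Type*} [TopologicalSpace M] [ChartedSpace H M] [IsManifold I ∞ M]

theorem contMDiff_of_comp_extChartAt_symm {G : Type*} [NormedAddCommGroup G] [NormedSpace ℝ G]
    {g : M → G}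
    (hg : ∀ x : M, ContDiffAt ℝ ∞ (g ∘ (extChartAt I x).symm) (extChartAt I x x)) :
    ContMDiff I 𝓘(ℝ, G) ∞ g := by
  intro x
  refine ((hg x).contMDiffAt.comp x contMDiffAt_extChartAt).congr_of_eventuallyEq ?_
  filter_upwards [extChartAt_source_mem_nhds (I := I) x] with z hz
  rw [Function.comp_apply, Function.comp_apply, (extChartAt I x).left_inv hz]

theorem contDiffAt_comp_extChartAt_symm {G : Type*} [NormedAddCommGroup G] [NormedSpace ℝ G]
    {g : M → G} (hg : ContMDiff I 𝓘(ℝ, G) ∞ g) {x₀ : M} {y : E}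
    (hy : y ∈ (extChartAt I x₀).target) : ContDiffAt ℝ ∞ (g ∘ (extChartAt I x₀).symm) y :=
  (ContMDiffAt.comp y (hg _) (contMDiffAt_extChartAt_symm hy)).contDiffAt

/-- A covector field is smooth if its components in the charts are smooth. -/
theorem isSmooth_toForm {α : Covector I M} (β : M → E → E →L[ℝ] ℝ)
    (hβ : ∀ (x₀ : M), ∀ y ∈ (extChartAt I x₀).target, ContDiffAt ℝ ∞ (β x₀) y)
    (h : ∀ (x₀ : M), ∀ y ∈ (extChartAt I x₀).target, ∀ u : E, α ((extChartAt I x₀).symm y)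
      (mfderiv 𝓘(ℝ, E) I (extChartAt I x₀).symm y u) = β x₀ y u) :
    IsSmooth I (Covector.toForm I α) := by
  refine isSmooth_iff.2 fun x₀ y hy => ?_
  let O := ContinuousAlternatingMap.ofSubsingletonLIE (𝕜 := ℝ) (E := E) (F := ℝ) (0 : Fin 1)
  refine ContDiffAt.congr_of_eventuallyEq (f := fun z => O (β x₀ z))
    (O.contDiff.contDiffAt.comp y (hβ x₀ y hy)) ?_
  filter_upwards [(isOpen_extChartAt_target x₀).mem_nhds hy] with z hz
  rw [inChart_eq_pullbackModel]
  ext v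
  exact h x₀ z hz (v 0)

/-- The exterior derivative of a `1`-form in a chart. -/
theorem d_toForm_apply {α : Covector I M} (hα : IsSmooth I (Covector.toForm I α)) {x₀ : M} {y : E}
    (hy : y ∈ (extChartAt I x₀).target) {β : E → E →L[ℝ] ℝ}
    (h : ∀ y ∈ (extChartAt I x₀).target, ∀ u : E, α ((extChartAt I x₀).symm y)
      (mfderiv 𝓘(ℝ, E) I (extChartAt I x₀).symm y u) = β y u) (a b : E) :
    d I (Covector.toForm I α) ((extChartAt I x₀).symm y)
      ![mfderiv 𝓘(ℝ, E) I (extChartAt I x₀).symm y a,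
        mfderiv 𝓘(ℝ, E) I (extChartAt I x₀).symm y b] =
      fderiv ℝ (fun z => β z b) y a - fderiv ℝ (fun z => β z a) y b := by
  have hc := contMDiffAt_extChartAt_symm (I := I) hy
  rw [← pullbackModel_apply_two, ← extDeriv_pullbackModel hα hc,
    extDeriv_one_form_apply ((hα.contDiffAt_pullbackModel hc).differentiableAt (by simp))]
  have h1 : ∀ u, (fun z => pullbackModel I (extChartAt I x₀).symm (Covector.toForm I α) z ![u])
      =ᶠ[𝓝 y] fun z => β z u := by
    intro u
    filter_upwards [(isOpen_extChartAt_target x₀).mem_nhds hy] with z hz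
    exact h z hz u
  rw [(h1 a).fderiv_eq, (h1 b).fderiv_eq]

end DiffForm

namespace TimeDependent

open DiffForm

variable {n : ℕ} {Q : Type*} [TopologicalSpace Q] [ChartedSpace (EuclideanSpace ℝ (Fin n)) Q]
  [IsManifold (𝓡 n) ∞ Q]

local notation "𝕍" => EuclideanSpace ℝ (Fin n)

/-- Every point has coordinates in some natural chart; the centre of the chart is kept independent of
the point, so that the point can be replaced by its expression in coordinates. -/
theorem exists_phaseChart_symm (p : Phase n Q) : ∃ (p₀ : Phase n Q) (y : (𝕍 × 𝕍) × ℝ),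
    y ∈ (extChartAt (phaseModel n) p₀).target ∧ (extChartAt (phaseModel n) p₀).symm y = p :=
  ⟨p, _, mem_extChartAt_target (I := phaseModel n) p, extChartAt_to_inv p⟩

variable {L : Phase n Q → ℝ}

theorem isSmooth_cartanOne (hL : ContMDiff (phaseModel n) 𝓘(ℝ, ℝ) ∞ L) :
    IsSmooth (phaseModel n) (Covector.toForm (phaseModel n) (cartanOne L)) :=
  isSmooth_toForm (fun p₀ => Coord.cartan (L ∘ (extChartAt (phaseModel n) p₀).symm))
    (fun _ _ hy => Coord.contDiffAt_cartan (contDiffAt_comp_extChartAt_symm hL hy))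
    fun _ _ hy u => cartanOne_mfderiv_phaseChart_symm hL hy u

theorem cartanTwo_mfderiv_phaseChart_symm (hL : ContMDiff (phaseModel n) 𝓘(ℝ, ℝ) ∞ L)
    {p₀ : Phase n Q} {y : (𝕍 × 𝕍) × ℝ} (hy : y ∈ (extChartAt (phaseModel n) p₀).target)
    (a b : (𝕍 × 𝕍) × ℝ) :
    cartanTwo L ((extChartAt (phaseModel n) p₀).symm y)
      ![mfderiv 𝓘(ℝ, (𝕍 × 𝕍) × ℝ) (phaseModel n) (extChartAt (phaseModel n) p₀).symm y a,
        mfderiv 𝓘(ℝ, (𝕍 × 𝕍) × ℝ) (phaseModel n) (extChartAt (phaseModel n) p₀).symm y b] =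
      -(fderiv ℝ (fun z => Coord.cartan (L ∘ (extChartAt (phaseModel n) p₀).symm) z b) y a -
        fderiv ℝ (fun z => Coord.cartan (L ∘ (extChartAt (phaseModel n) p₀).symm) z a) y b) :=
  congrArg Neg.neg (d_toForm_apply (isSmooth_cartanOne hL) hy
    (fun _ hz u => cartanOne_mfderiv_phaseChart_symm hL hz u) a b)

/-- In natural coordinates the fibre Hessian is the second derivative of `L` in the directions
`∂/∂v^μ`, up to the change of basis given by the chart. -/
theorem eq_zero_of_fibreHessian (hL : ContMDiff (phaseModel n) 𝓘(ℝ, ℝ) ∞ L) {p₀ : Phase n Q}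
    {y : (𝕍 × 𝕍) × ℝ} (hy : y ∈ (extChartAt (phaseModel n) p₀).target)
    (hreg : (fibreHessian L ((extChartAt (phaseModel n) p₀).symm y)).det ≠ 0) {a : 𝕍}
    (ha : ∀ b, fderiv ℝ (fderiv ℝ (L ∘ (extChartAt (phaseModel n) p₀).symm)) y
      ((0, b), 0) ((0, a), 0) = 0) : a = 0 := by
  have hq := mem_phaseChart_target.1 hy
  rw [phaseChart_symm_apply hy] at hreg
  set ψ := extChartAt (𝓡 n) p₀.1.proj
  set φ := extChartAt (phaseModel n) p₀
  set l := L ∘ φ.symm with hl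
  let τ : 𝕍 →L[ℝ] 𝕍 := mfderiv 𝓘(ℝ, 𝕍) (𝓡 n) ψ.symm y.1.1
  let τ' : 𝕍 →L[ℝ] 𝕍 := mfderiv (𝓡 n) 𝓘(ℝ, 𝕍) ψ (ψ.symm y.1.1)
  have hττ' : ∀ u, τ (τ' u) = u := fun u =>
    mfderiv_extChartAt_symm_mfderiv_extChartAt (I := 𝓡 n) (x₀ := p₀.1.proj) hq u
  have hτ'τ : ∀ u, τ' (τ u) = u := fun u =>
    mfderiv_extChartAt_mfderiv_extChartAt_symm (I := 𝓡 n) (x₀ := p₀.1.proj) hq u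
  have htgt : ∀ u, ((y.1.1, u), y.2) ∈ φ.target := fun u => mem_phaseChart_target.2 hq
  have hsm : ∀ u, ContDiffAt ℝ ∞ l ((y.1.1, u), y.2) := fun u =>
    contDiffAt_comp_extChartAt_symm hL (htgt u)
  let J : 𝕍 →L[ℝ] (𝕍 × 𝕍) × ℝ := ((0 : 𝕍 →L[ℝ] 𝕍).prod τ').prod (0 : 𝕍 →L[ℝ] ℝ)
  let c : 𝕍 → (𝕍 × 𝕍) × ℝ := fun u => ((y.1.1, τ' u), y.2)
  have hc : ∀ u, HasFDerivAt c J u := fun u =>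
    ((hasFDerivAt_const _ u).prodMk τ'.hasFDerivAt).prodMk (hasFDerivAt_const _ u)
  have hg : (fun u : 𝕍 => L (⟨ψ.symm y.1.1, u⟩, y.2)) = l ∘ c := by
    funext u
    have h := phaseChart_symm_apply (htgt (τ' u))
    rw [hl, Function.comp_apply, Function.comp_apply]
    refine Eq.trans ?_ (congrArg L h).symm
    exact congrArg (fun u : 𝕍 => L ((⟨ψ.symm y.1.1, u⟩, y.2) : Phase n Q)) (hττ' u).symm
  have hD : fderiv ℝ (l ∘ c) = fun u => (fderiv ℝ l (c u)).comp J := by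
    funext u
    exact (((hsm _).differentiableAt (by simp)).hasFDerivAt.comp u (hc u)).fderiv
  have hDD : ∀ u a b, fderiv ℝ (fderiv ℝ (l ∘ c)) u a b =
      fderiv ℝ (fderiv ℝ l) (c u) (J a) (J b) := by
    intro u a b
    have h1 : HasFDerivAt (fun u => fderiv ℝ l (c u))
        ((fderiv ℝ (fderiv ℝ l) (c u)).comp J) u :=
      ((((hsm _).fderiv_right (m := ∞) (by simp)).differentiableAt
        (by simp)).hasFDerivAt).comp u (hc u)
    have h2 := h1.clm_comp (hasFDerivAt_const J u)
    rw [hD, h2.fderiv]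
    simp
  have hcy : c (τ y.1.2) = y := by
    simp only [c, hτ'τ]
  have hH : fibreHessian L (chartPoint p₀.1.proj y) = Matrix.of fun μ ν =>
      fderiv ℝ (fderiv ℝ l) y (J (EuclideanSpace.single μ 1)) (J (EuclideanSpace.single ν 1)) := by
    ext μ ν
    change iteratedFDeriv ℝ 2 (fun u : 𝕍 => L (⟨ψ.symm y.1.1, u⟩, y.2)) (τ y.1.2) _ = _
    rw [hg, iteratedFDeriv_two_apply, hDD, hcy]
    rfl
  have hJ : J (τ a) = ((0, a), 0) := by
    change (((0 : 𝕍), τ' (τ a)), (0 : ℝ)) = _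
    rw [hτ'τ]
  have hsum : ∀ v : 𝕍, v = ∑ ν, v ν • EuclideanSpace.single ν (1 : ℝ) := by
    intro v
    simpa using ((EuclideanSpace.basisFun (Fin n) ℝ).sum_repr v).symm
  have hz : (fun ν => τ a ν) = 0 := by
    refine Matrix.eq_zero_of_mulVec_eq_zero hreg ?_
    funext μ
    have h1 := ha (τ' (EuclideanSpace.single μ 1))
    rw [← hJ] at h1
    change fderiv ℝ (fderiv ℝ l) y (J (EuclideanSpace.single μ 1)) (J (τ a)) = 0 at h1
    rw [hsum (τ a), map_sum J,
      map_sum (fderiv ℝ (fderiv ℝ l) y (J (EuclideanSpace.single μ 1)))] at h1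
    rw [hH]
    refine Eq.trans ?_ h1
    change ∑ ν, fderiv ℝ (fderiv ℝ l) y (J (EuclideanSpace.single μ 1))
      (J (EuclideanSpace.single ν 1)) * τ a ν = _
    refine Finset.sum_congr rfl fun ν _ => ?_
    rw [map_smul J, map_smul, smul_eq_mul, mul_comm]
  rw [← hτ'τ a, show τ a = 0 from PiLp.ext fun ν => congrFun hz ν, map_zero]

/-- For a regular Lagrangian, `Ω_L` is non-degenerate on vertical vectors. -/
theorem eq_zero_of_cartanTwo (hL : ContMDiff (phaseModel n) 𝓘(ℝ, ℝ) ∞ L) (hreg : IsRegular L)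
    (p : Phase n Q) {w : TangentSpace (phaseModel n) p} (hw : dt p w = 0)
    (h : ∀ u : TangentSpace (phaseModel n) p, dt p u = 0 → cartanTwo L p ![w, u] = 0) : w = 0 := by
  obtain ⟨p₀, y, hy, rfl⟩ := exists_phaseChart_symm p
  obtain ⟨w, rfl⟩ := mfderiv_extChartAt_symm_surjective (I := phaseModel n) hy w
  rw [Coord.eq_zero_of_fderiv_cartan (contDiffAt_comp_extChartAt_symm hL hy)
    (fun a ha => eq_zero_of_fibreHessian hL hy (hreg _) ha)
    ((dt_mfderiv_phaseChart_symm hy w).symm.trans hw) fun u hu => ?_]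
  · exact map_zero _
  · have h1 := h _ ((dt_mfderiv_phaseChart_symm hy u).trans hu)
    exact neg_eq_zero.1 ((cartanTwo_mfderiv_phaseChart_symm hL hy w u).symm.trans h1)

namespace Connection

variable (C : Connection n Q)

theorem dt_jetLift (p : Phase n Q) : dt p (C.jetLift p) = 1 := dt_apply p _

theorem energy_phaseChart_symm (hL : ContMDiff (phaseModel n) 𝓘(ℝ, ℝ) ∞ L) {p₀ : Phase n Q}
    {y : (𝕍 × 𝕍) × ℝ} (hy : y ∈ (extChartAt (phaseModel n) p₀).target) :
    C.energy L ((extChartAt (phaseModel n) p₀).symm y) =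
      -Coord.cartan (L ∘ (extChartAt (phaseModel n) p₀).symm) y
        (Coord.jet (C.components p₀.1.proj) y) := by
  rw [← cartanOne_mfderiv_phaseChart_symm hL hy]
  exact congrArg (fun u : (𝕍 × 𝕍) × ℝ =>
    -cartanOne L ((extChartAt (phaseModel n) p₀).symm y) u) (C.jetLift_phaseChart_symm hy)

theorem contMDiff_energy (hL : ContMDiff (phaseModel n) 𝓘(ℝ, ℝ) ∞ L) :
    ContMDiff (phaseModel n) 𝓘(ℝ, ℝ) ∞ (C.energy L) := by
  refine contMDiff_of_comp_extChartAt_symm fun p => ?_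
  have hp := mem_extChartAt_target (I := phaseModel n) p
  have h := (Coord.contDiffAt_cartan (contDiffAt_comp_extChartAt_symm hL hp)).clm_apply
    (Coord.contDiffAt_jet (C.contDiffAt_components p.1.proj (mem_phaseChart_target.1 hp)))
  refine h.neg.congr_of_eventuallyEq ?_
  filter_upwards [(isOpen_extChartAt_target p).mem_nhds hp] with z hz
  exact C.energy_phaseChart_symm hL hz

/-- For an infinitesimal symmetry, `i(j¹Ỹ) Ω_L = -dE_L^∇`. -/
theorem cartanTwo_jetLift (hL : ContMDiff (phaseModel n) 𝓘(ℝ, ℝ) ∞ L) (hsymm : C.IsSymmetry L)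
    (p : Phase n Q) (w : TangentSpace (phaseModel n) p) :
    cartanTwo L p ![C.jetLift p, w] = -dFun (C.energy L) p w := by
  obtain ⟨p₀, y, hy, rfl⟩ := exists_phaseChart_symm p
  obtain ⟨w, rfl⟩ := mfderiv_extChartAt_symm_surjective (I := phaseModel n) hy w
  set φ := extChartAt (phaseModel n) p₀
  set Γ := C.components p₀.1.proj
  have h0 : ∀ᶠ z in 𝓝 y, z ∈ φ.target := (isOpen_extChartAt_target p₀).mem_nhds hy
  have h1 : ∀ᶠ z in 𝓝 y, fderiv ℝ (L ∘ φ.symm) z (Coord.jet Γ z) = 0 := by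
    filter_upwards [h0] with z hz
    refine (mfderiv_extChartAt_symm_comp hz ((hL _).mdifferentiableAt (by simp)) _).trans ?_
    refine Eq.trans ?_ (hsymm (φ.symm z))
    exact congrArg (fun u : (𝕍 × 𝕍) × ℝ => dFun L (φ.symm z) u)
      (C.jetLift_phaseChart_symm hz).symm
  have h2 : C.energy L ∘ φ.symm =ᶠ[𝓝 y] fun z => -Coord.cartan (L ∘ φ.symm) z (Coord.jet Γ z) := by
    filter_upwards [h0] with z hz using C.energy_phaseChart_symm hL hz
  have h3 := Coord.fderiv_cartan_jet (contDiffAt_comp_extChartAt_symm hL hy)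
    (C.contDiffAt_components p₀.1.proj (mem_phaseChart_target.1 hy)) h1 w
  rw [← h2.fderiv_eq, mfderiv_extChartAt_symm_comp hy
    ((C.contMDiff_energy hL _).mdifferentiableAt (by simp))] at h3
  have h4 := cartanTwo_mfderiv_phaseChart_symm hL hy (Coord.jet Γ y) w
  rw [h3] at h4
  refine Eq.trans ?_ h4
  exact congrArg (fun u : (𝕍 × 𝕍) × ℝ => cartanTwo L (φ.symm y) ![u,
    mfderiv 𝓘(ℝ, (𝕍 × 𝕍) × ℝ) (phaseModel n) φ.symm y w]) (C.jetLift_phaseChart_symm hy)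

/-- The energy is constant along `j¹Ỹ`. -/
theorem dFun_energy_jetLift (hL : ContMDiff (phaseModel n) 𝓘(ℝ, ℝ) ∞ L) (hsymm : C.IsSymmetry L)
    (p : Phase n Q) : dFun (C.energy L) p (C.jetLift p) = 0 := by
  have h := C.cartanTwo_jetLift hL hsymm p (C.jetLift p)
  rw [(cartanTwo L p).map_eq_zero_of_eq ![C.jetLift p, C.jetLift p] (i := 0) (j := 1) rfl
    (by simp)] at h
  exact neg_eq_zero.1 h.symm

theorem cartanVert_apply (hL : ContMDiff (phaseModel n) 𝓘(ℝ, ℝ) ∞ L) (hsymm : C.IsSymmetry L)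
    (p : Phase n Q) (u v : TangentSpace (phaseModel n) p) :
    C.cartanVert L p ![u, v] = cartanTwo L p ![u, v] +
      (dt p u * dFun (C.energy L) p v - dt p v * dFun (C.energy L) p u) := by
  change cartanTwo L p ![u, v] - wedge (phaseModel n) (dt p)
    (interiorProduct (phaseModel n) (C.jetLift p) (cartanTwo L p)) ![u, v] = _
  rw [wedge_apply, interiorProduct_apply, interiorProduct_apply, C.cartanTwo_jetLift hL hsymm,
    C.cartanTwo_jetLift hL hsymm]
  ring

theorem cartanVert_jetLift (hL : ContMDiff (phaseModel n) 𝓘(ℝ, ℝ) ∞ L) (hsymm : C.IsSymmetry L)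
    (p : Phase n Q) (w : TangentSpace (phaseModel n) p) :
    C.cartanVert L p ![C.jetLift p, w] = 0 := by
  rw [C.cartanVert_apply hL hsymm, C.cartanTwo_jetLift hL hsymm, C.dFun_energy_jetLift hL hsymm,
    dt_jetLift]
  ring

/-- The `1`-form `-(Θ_L + E_L^∇ dt)`, which vanishes on `j¹Ỹ`. For an infinitesimal symmetry it is
a potential of `Ω_L^V`. -/
def vertPotential (L : Phase n Q → ℝ) : Covector (phaseModel n) (Phase n Q) :=
  fun p => -(cartanOne L p + C.energy L p • dt p)

theorem vertPotential_jetLift (p : Phase n Q) : C.vertPotential L p (C.jetLift p) = 0 := by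
  change -(cartanOne L p (C.jetLift p) + -cartanOne L p (C.jetLift p) * dt p (C.jetLift p)) = 0
  rw [dt_jetLift]
  ring

theorem vertPotential_mfderiv_phaseChart_symm (hL : ContMDiff (phaseModel n) 𝓘(ℝ, ℝ) ∞ L)
    {p₀ : Phase n Q} {y : (𝕍 × 𝕍) × ℝ} (hy : y ∈ (extChartAt (phaseModel n) p₀).target)
    (w : (𝕍 × 𝕍) × ℝ) :
    C.vertPotential L ((extChartAt (phaseModel n) p₀).symm y)
      (mfderiv 𝓘(ℝ, (𝕍 × 𝕍) × ℝ) (phaseModel n) (extChartAt (phaseModel n) p₀).symm y w) =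
      (-(Coord.cartan (L ∘ (extChartAt (phaseModel n) p₀).symm) y +
        (C.energy L ∘ (extChartAt (phaseModel n) p₀).symm) y •
          ContinuousLinearMap.snd ℝ (𝕍 × 𝕍) ℝ)) w :=
  congrArg₂ (fun a b => -(a + C.energy L ((extChartAt (phaseModel n) p₀).symm y) * b))
    (cartanOne_mfderiv_phaseChart_symm hL hy w) (dt_mfderiv_phaseChart_symm hy w)

theorem isSmooth_vertPotential (hL : ContMDiff (phaseModel n) 𝓘(ℝ, ℝ) ∞ L) :
    IsSmooth (phaseModel n) (Covector.toForm (phaseModel n) (C.vertPotential L)) :=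
  isSmooth_toForm (fun p₀ y => -(Coord.cartan (L ∘ (extChartAt (phaseModel n) p₀).symm) y +
      (C.energy L ∘ (extChartAt (phaseModel n) p₀).symm) y •
        ContinuousLinearMap.snd ℝ (𝕍 × 𝕍) ℝ))
    (fun _ _ hy => ((Coord.contDiffAt_cartan (contDiffAt_comp_extChartAt_symm hL hy)).add
      ((contDiffAt_comp_extChartAt_symm (C.contMDiff_energy hL) hy).smul contDiffAt_const)).neg)
    fun _ _ hy u => C.vertPotential_mfderiv_phaseChart_symm hL hy u

/-- Since `i(j¹Ỹ) Ω_L = -dE_L^∇`, the vertical part of `Ω_L` is exact. -/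
theorem cartanVert_eq (hL : ContMDiff (phaseModel n) 𝓘(ℝ, ℝ) ∞ L) (hsymm : C.IsSymmetry L) :
    C.cartanVert L = d (phaseModel n) (Covector.toForm (phaseModel n) (C.vertPotential L)) := by
  funext p
  ext v
  obtain ⟨a, b, rfl⟩ : ∃ a b, v = ![a, b] := ⟨v 0, v 1, by
    ext i
    fin_cases i <;> rfl⟩
  rw [C.cartanVert_apply hL hsymm]
  obtain ⟨p₀, y, hy, rfl⟩ := exists_phaseChart_symm p
  obtain ⟨a, rfl⟩ := mfderiv_extChartAt_symm_surjective (I := phaseModel n) hy a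
  obtain ⟨b, rfl⟩ := mfderiv_extChartAt_symm_surjective (I := phaseModel n) hy b
  set φ := extChartAt (phaseModel n) p₀
  have hE : ContDiffAt ℝ ∞ (C.energy L ∘ φ.symm) y :=
    contDiffAt_comp_extChartAt_symm (C.contMDiff_energy hL) hy
  have hθ := (Coord.contDiffAt_cartan (contDiffAt_comp_extChartAt_symm hL hy)).differentiableAt
    (by simp)
  have h1 : ∀ a b, fderiv ℝ (fun z => (-(Coord.cartan (L ∘ φ.symm) z +
      (C.energy L ∘ φ.symm) z • ContinuousLinearMap.snd ℝ (𝕍 × 𝕍) ℝ)) b) y a =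
      -(fderiv ℝ (fun z => Coord.cartan (L ∘ φ.symm) z b) y a +
        dFun (C.energy L) (φ.symm y)
          (mfderiv 𝓘(ℝ, (𝕍 × 𝕍) × ℝ) (phaseModel n) φ.symm y a) * b.2) := by
    intro a b
    have h2 : HasFDerivAt (fun z => Coord.cartan (L ∘ φ.symm) z b)
        (fderiv ℝ (fun z => Coord.cartan (L ∘ φ.symm) z b) y) y :=
      (hθ.clm_apply (differentiableAt_const b)).hasFDerivAt
    have h3 := (h2.add ((hE.differentiableAt (by simp)).hasFDerivAt.mul_const b.2)).neg
    have h4 : fderiv ℝ (C.energy L ∘ φ.symm) y a = dFun (C.energy L) (φ.symm y)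
        (mfderiv 𝓘(ℝ, (𝕍 × 𝕍) × ℝ) (phaseModel n) φ.symm y a) :=
      mfderiv_extChartAt_symm_comp hy ((C.contMDiff_energy hL _).mdifferentiableAt (by simp)) a
    have h5 := DFunLike.congr_fun h3.fderiv a
    refine h5.trans ?_
    rw [← h4]
    simp [mul_comm]
  rw [cartanTwo_mfderiv_phaseChart_symm hL hy, dt_mfderiv_phaseChart_symm hy,
    dt_mfderiv_phaseChart_symm hy, d_toForm_apply (C.isSmooth_vertPotential hL) hy
    (fun _ hz u => C.vertPotential_mfderiv_phaseChart_symm hL hz u), h1, h1]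
  ring

end Connection

end TimeDependent

/-! ### Orbits of the canonical lift -/

/-- Limits in `TM` are unique: their base points agree, so they lie in a common chart. -/
theorem t2Space_tangentBundle {E : Type*} [NormedAddCommGroup E] [NormedSpace ℝ E]
    {H : Type*} [TopologicalSpace H] [T2Space H] (I : ModelWithCorners ℝ E H)
    (M : Type*) [TopologicalSpace M] [ChartedSpace H M] [IsManifold I 1 M] [T2Space M] :
    T2Space (TangentBundle I M) := by
  refine t2_iff_nhds.2 fun {x y} h => ?_
  have hproj : x.proj = y.proj := by
    have hc : Continuous (Bundle.TotalSpace.proj : TangentBundle I M → M) :=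
      FiberBundle.continuous_proj E (TangentSpace I : M → Type _)
    exact tendsto_nhds_unique ((hc.tendsto x).mono_left inf_le_left)
      ((hc.tendsto y).mono_left inf_le_right)
  set e := chartAt (ModelProd H E) x
  have hx : x ∈ e.source := mem_chart_source _ x
  have hy : y ∈ e.source := by
    rw [TangentBundle.mem_chart_source_iff, ← hproj]
    exact mem_chart_source H x.proj
  have : T2Space (ModelProd H E) := inferInstanceAs (T2Space (H × E))
  exact e.injOn hx hy (tendsto_nhds_unique ((e.continuousAt hx).mono_left inf_le_left)
    ((e.continuousAt hy).mono_left inf_le_right))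

theorem IsMIntegralCurve.hasDerivAt_comp {E : Type*} [NormedAddCommGroup E] [NormedSpace ℝ E]
    {H : Type*} [TopologicalSpace H] {I : ModelWithCorners ℝ E H}
    {M : Type*} [TopologicalSpace M] [ChartedSpace H M] {γ : ℝ → M} {X : DiffForm.VField I M}
    (hγ : IsMIntegralCurve γ X) {g : M → ℝ} (hg : MDifferentiable I 𝓘(ℝ, ℝ) g) (s : ℝ) :
    HasDerivAt (g ∘ γ) (mfderiv I 𝓘(ℝ, ℝ) g (γ s) (X (γ s))) s := by
  let A : ℝ →L[ℝ] ℝ := (mfderiv I 𝓘(ℝ, ℝ) g (γ s)).comp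
    ((1 : ℝ →L[ℝ] ℝ).smulRight (X (γ s)) : ℝ →L[ℝ] TangentSpace I (γ s))
  have h : HasFDerivAt (g ∘ γ) A s := ((hg (γ s)).hasMFDerivAt.comp s (hγ s)).hasFDerivAt
  have h1 : A 1 = mfderiv I 𝓘(ℝ, ℝ) g (γ s) (X (γ s)) := by
    change mfderiv I 𝓘(ℝ, ℝ) g (γ s) ((1 : ℝ) • X (γ s)) = _
    rw [one_smul]
  exact h1 ▸ h.hasDerivAt

namespace TimeDependent

open DiffForm

variable {n : ℕ} {Q : Type*} [TopologicalSpace Q] [ChartedSpace (EuclideanSpace ℝ (Fin n)) Q]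
  [IsManifold (𝓡 n) ∞ Q]

local notation "𝕍" => EuclideanSpace ℝ (Fin n)

namespace Connection

variable {C : Connection n Q} {γ γ' : ℝ → Phase n Q}

/-- The time coordinate is an affine parameter of the integral curves of `j¹Ỹ`. -/
theorem snd_integralCurve (hγ : IsMIntegralCurve (I := phaseModel n) γ C.jetLift) (s : ℝ) :
    (γ s).2 = (γ 0).2 + s := by
  have h1 : ∀ s, HasDerivAt (fun s => (γ s).2 - s) 0 s := fun s => by
    have h := hγ.hasDerivAt_comp (g := fun p : Phase n Q => p.2)
      ((contMDiff_snd (n := 1)).mdifferentiable (by simp)) s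
    have h2 : mfderiv (phaseModel n) 𝓘(ℝ, ℝ) (fun p : Phase n Q => p.2) (γ s) (C.jetLift (γ s)) =
      1 := C.dt_jetLift (γ s)
    rw [h2] at h
    have h3 : HasDerivAt (fun s => (γ s).2) (1 : ℝ) s := h
    have h4 := h3.sub (hasDerivAt_id s)
    rw [sub_self] at h4
    exact h4
  have h2 : (γ s).2 - s = (γ 0).2 - 0 := is_const_of_deriv_eq_zero
    (fun s => (h1 s).differentiableAt) (fun s => (h1 s).deriv) s 0
  linarith

variable [T2Space Q]

theorem integralCurve_unique (hγ : IsMIntegralCurve (I := phaseModel n) γ C.jetLift)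
    (hγ' : IsMIntegralCurve (I := phaseModel n) γ' C.jetLift) {t₀ : ℝ} (h : γ t₀ = γ' t₀) :
    γ = γ' := by
  have : T2Space (TangentBundle (𝓡 n) Q) := t2Space_tangentBundle (𝓡 n) Q
  exact isMIntegralCurve_Ioo_eq_of_contMDiff_boundaryless
    (C.contMDiff_jetLift.of_le (by simp)) hγ hγ' h

/-- Integral curves with the same orbit differ by a translation of the parameter. -/
theorem SameOrbit.exists_eq {p q : Phase n Q} (h : C.SameOrbit p q)
    (hγ : IsMIntegralCurve (I := phaseModel n) γ C.jetLift) {s : ℝ} (hs : γ s = p) :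
    ∃ s', γ s' = q := by
  obtain ⟨δ, hδ, r, r', hr, hr'⟩ := h
  have h1 := integralCurve_unique (hγ.comp_add (s - r)) hδ (t₀ := r) (by simp [hs, hr])
  exact ⟨r' + (s - r), (congrFun h1 r').trans hr'⟩

theorem equivalence_sameOrbit (hC : C.IsComplete) : Equivalence C.SameOrbit where
  refl p := by
    obtain ⟨γ, h0, hγ⟩ := hC p
    exact ⟨γ, hγ, 0, 0, h0, h0⟩
  symm := by
    rintro p q ⟨γ, hγ, s, s', h, h'⟩
    exact ⟨γ, hγ, s', s, h', h⟩
  trans := by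
    rintro p q r ⟨γ, hγ, s, s', h, h'⟩ hqr
    obtain ⟨s'', h''⟩ := hqr.exists_eq hγ h'
    exact ⟨γ, hγ, s, s'', h, h''⟩

theorem proj_integralCurve (hγ : IsMIntegralCurve (I := phaseModel n) γ C.jetLift) (s s' : ℝ) :
    C.proj (γ s) = C.proj (γ s') :=
  Quot.sound ⟨γ, hγ, s, s', rfl, rfl⟩

/-- Each fibre of the projection is the image of a single integral curve, parametrized by time. -/
theorem eq_integralCurve_of_proj_eq (hC : C.IsComplete)
    (hγ : IsMIntegralCurve (I := phaseModel n) γ C.jetLift) {q : Phase n Q}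
    (h : C.proj q = C.proj (γ 0)) : q = γ (q.2 - (γ 0).2) := by
  have h1 : C.SameOrbit (γ 0) q :=
    (equivalence_sameOrbit hC).eqvGen_iff.1 (Quot.eqvGen_exact h.symm)
  obtain ⟨s, rfl⟩ := h1.exists_eq hγ rfl
  rw [snd_integralCurve hγ s, add_sub_cancel_left]

theorem isPreconnected_fibre (hC : C.IsComplete) (x : C.Reduced) :
    IsPreconnected (C.proj ⁻¹' {x}) := by
  obtain ⟨p, rfl⟩ := Quot.exists_rep x
  obtain ⟨γ, rfl, hγ⟩ := hC p
  have h : C.proj ⁻¹' {C.proj (γ 0)} = Set.range γ := by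
    ext q
    refine ⟨fun hq => ⟨_, (eq_integralCurve_of_proj_eq hC hγ hq).symm⟩, ?_⟩
    rintro ⟨s, rfl⟩
    exact proj_integralCurve hγ s 0
  exact h ▸ isPreconnected_range hγ.continuous

section

variable {m : ℕ} [ChartedSpace (EuclideanSpace ℝ (Fin m)) C.Reduced]
  [IsManifold (𝓡 m) ∞ C.Reduced]

theorem mfderiv_proj_jetLift (hC : C.IsComplete)
    (hproj : Manifold.IsSubmersion (phaseModel n) (𝓡 m) ∞ C.proj) (p : Phase n Q) :
    mfderiv (phaseModel n) (𝓡 m) C.proj p (C.jetLift p) = 0 := by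
  obtain ⟨γ, rfl, hγ⟩ := hC p
  have h1 : MDifferentiableAt (phaseModel n) (𝓡 m) C.proj (γ 0) :=
    (hproj.contMDiff _).mdifferentiableAt (by simp)
  have h2 := (h1.hasMFDerivAt.comp 0 (hγ 0)).mfderiv
  have h3 : C.proj ∘ γ = fun _ => C.proj (γ 0) := funext fun s => proj_integralCurve hγ s 0
  rw [h3, mfderiv_const] at h2
  have h4 : (0 : EuclideanSpace ℝ (Fin m)) =
      mfderiv (phaseModel n) (𝓡 m) C.proj (γ 0) ((1 : ℝ) • C.jetLift (γ 0)) :=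
    DFunLike.congr_fun h2 (1 : ℝ)
  rw [one_smul] at h4
  exact h4.symm

/-- The fibres of the projection are one-dimensional: their tangent vectors are the multiples of
`j¹Ỹ`. -/
theorem eq_smul_jetLift (hC : C.IsComplete)
    (hproj : Manifold.IsSubmersion (phaseModel n) (𝓡 m) ∞ C.proj) (p : Phase n Q)
    {w : TangentSpace (phaseModel n) p}
    (hw : mfderiv (phaseModel n) (𝓡 m) C.proj p w = 0) : w = dt p w • C.jetLift p := by
  obtain ⟨γ, rfl, hγ⟩ := hC p
  obtain ⟨F, _, _, hF⟩ := id hproj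
  obtain ⟨c⟩ := exists_submersionChart (hF (γ 0))
  obtain ⟨δ, h0, hδ, hδw, hfib⟩ := c.exists_curve_in_fibre
    ((hproj.contMDiff _).mdifferentiableAt (by simp)) hw
  let g : ℝ → ℝ := fun r => (δ r).2 - (γ 0).2
  have hg0 : g 0 = 0 := by simp [g, h0]
  have hg : HasDerivAt g (dt (γ 0) w) 0 := by
    have h1 : HasMFDerivAt (phaseModel n) 𝓘(ℝ, ℝ) (fun p : Phase n Q => p.2) (δ 0)
        (dt (δ 0)) := by
      exact ((contMDiff_snd (n := 1)).mdifferentiable (by simp) _).hasMFDerivAt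
    let A : ℝ →L[ℝ] ℝ := (dt (δ 0)).comp (mfderiv 𝓘(ℝ, ℝ) (phaseModel n) δ 0)
    have h2 : HasFDerivAt (fun r => (δ r).2) A 0 := (h1.comp 0 hδ.hasMFDerivAt).hasFDerivAt
    have h3 : A 1 = dt (γ 0) w := by
      change dt (δ 0) (mfderiv 𝓘(ℝ, ℝ) (phaseModel n) δ 0 (1 : ℝ)) = _
      rw [dt_apply, dt_apply]
      exact congrArg (fun u : (𝕍 × 𝕍) × ℝ => u.2) hδw
    exact h3 ▸ h2.hasDerivAt.sub_const (γ 0).2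
  -- A curve in the fibre is the integral curve, reparametrized by the time coordinate.
  have h1 : δ =ᶠ[𝓝 0] γ ∘ g := by
    filter_upwards [hfib] with r hr using eq_integralCurve_of_proj_eq hC hγ hr
  have h2 : HasMFDerivAt 𝓘(ℝ, ℝ) (phaseModel n) γ (g 0)
      ((1 : ℝ →L[ℝ] ℝ).smulRight (C.jetLift (γ 0))) := by
    rw [hg0]
    exact hγ 0
  have h3 := (h2.comp 0 hg.hasFDerivAt.hasMFDerivAt).mfderiv
  have h4 : (mfderiv 𝓘(ℝ, ℝ) (phaseModel n) δ 0 (1 : ℝ) : (𝕍 × 𝕍) × ℝ) =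
      mfderiv 𝓘(ℝ, ℝ) (phaseModel n) (γ ∘ g) 0 (1 : ℝ) := DFunLike.congr_fun h1.mfderiv_eq (1 : ℝ)
  have h5 := DFunLike.congr_fun h3 (1 : ℝ)
  refine hδw.symm.trans (h4.trans (h5.trans ?_))
  change ((1 : ℝ) • dt (γ 0) w) • C.jetLift (γ 0) = _
  rw [one_smul]

end

end Connection

end TimeDependent

/-! ### The reduced Hamiltonian system -/

namespace DiffForm

variable {E : Type*} [NormedAddCommGroup E] [NormedSpace ℝ E]
  {H : Type*} [TopologicalSpace H] {I : ModelWithCorners ℝ E H}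
  {M : Type*} [TopologicalSpace M] [ChartedSpace H M]
  {E' : Type*} [NormedAddCommGroup E'] [NormedSpace ℝ E']
  {H' : Type*} [TopologicalSpace H'] {I' : ModelWithCorners ℝ E' H'}
  {N : Type*} [TopologicalSpace N] [ChartedSpace H' N]

theorem pullback_apply_two {f : M → N} (η : Form I' N 2) (p : M) (a b : TangentSpace I p) :
    pullback I I' f η p ![a, b] = η (f p) ![mfderiv I I' f p a, mfderiv I I' f p b] := by
  change η (f p) _ = _
  congr 1
  ext i
  fin_cases i <;> rfl

end DiffForm

namespace TimeDependent

open DiffForm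

variable {n : ℕ} {Q : Type*} [TopologicalSpace Q] [ChartedSpace (EuclideanSpace ℝ (Fin n)) Q]
  [IsManifold (𝓡 n) ∞ Q]

namespace Connection

variable {C : Connection n Q} {L : Phase n Q → ℝ}

theorem existsUnique_energy (hL : ContMDiff (phaseModel n) 𝓘(ℝ, ℝ) ∞ L) (hsymm : C.IsSymmetry L) :
    ∃! ℰ : C.Reduced → ℝ, ℰ ∘ C.proj = C.energy L := by
  have h : ∀ p q, C.SameOrbit p q → C.energy L p = C.energy L q := by
    rintro _ _ ⟨γ, hγ, s, s', rfl, rfl⟩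
    have h1 := fun s => hγ.hasDerivAt_comp ((C.contMDiff_energy hL).mdifferentiable (by simp)) s
    exact is_const_of_deriv_eq_zero (fun s => (h1 s).differentiableAt)
      (fun s => (h1 s).deriv.trans (C.dFun_energy_jetLift hL hsymm (γ s))) s s'
  refine ⟨Quot.lift (C.energy L) h, rfl, fun ℰ hℰ => ?_⟩
  funext x
  obtain ⟨p, rfl⟩ := Quot.exists_rep x
  exact congrFun hℰ p

variable [T2Space Q] {m : ℕ} [ChartedSpace (EuclideanSpace ℝ (Fin m)) C.Reduced]
  [IsManifold (𝓡 m) ∞ C.Reduced]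

/-- `Ω_L^V` is the pullback of an exact form: its potential vanishes on the fibres of the projection
and is invariant along them, hence descends. -/
theorem exists_pullback_eq_cartanVert (hL : ContMDiff (phaseModel n) 𝓘(ℝ, ℝ) ∞ L)
    (hC : C.IsComplete) (hsymm : C.IsSymmetry L)
    (hproj : Manifold.IsSubmersion (phaseModel n) (𝓡 m) ∞ C.proj) :
    ∃ η : Form (𝓡 m) C.Reduced 2, IsSmooth (𝓡 m) η ∧ d (𝓡 m) η = 0 ∧
      pullback (phaseModel n) (𝓡 m) C.proj η = C.cartanVert L := by
  obtain ⟨θ, hθ, hθL⟩ := exists_pullback_eq hproj Quot.mk_surjective (isPreconnected_fibre hC)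
    (C.isSmooth_vertPotential hL)
    (fun q w hw => by
      rw [eq_smul_jetLift hC hproj q hw, map_smul, vertPotential_jetLift, smul_zero])
    (fun q w u hw => by
      rw [← C.cartanVert_eq hL hsymm, eq_smul_jetLift hC hproj q hw]
      refine ((C.cartanVert L q).vecCons_smul ![u] (dt q w) (C.jetLift q)).trans ?_
      exact (congrArg (dt q w • ·) (C.cartanVert_jetLift hL hsymm q u)).trans (smul_zero _))
  exact ⟨_, hθ.d, hθ.d_d, by
    rw [← d_pullback hθ hproj.contMDiff, hθL, C.cartanVert_eq hL hsymm]⟩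

theorem isSymplectic_of_pullback_eq (hL : ContMDiff (phaseModel n) 𝓘(ℝ, ℝ) ∞ L)
    (hreg : IsRegular L) (hC : C.IsComplete) (hsymm : C.IsSymmetry L)
    (hproj : Manifold.IsSubmersion (phaseModel n) (𝓡 m) ∞ C.proj) {η : Form (𝓡 m) C.Reduced 2}
    (hη : pullback (phaseModel n) (𝓡 m) C.proj η = C.cartanVert L) : IsSymplectic (𝓡 m) η := by
  obtain ⟨η', h1, h2, h3⟩ := exists_pullback_eq_cartanVert hL hC hsymm hproj
  obtain rfl : η' = η := pullback_injective hproj Quot.mk_surjective (h3.trans hη.symm)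
  refine ⟨h1, h2, fun x X hX => ?_⟩
  obtain ⟨p, rfl⟩ := Quot.exists_rep x
  obtain ⟨w, rfl⟩ := mfderiv_surjective hproj p X
  -- Modulo the fibre direction, the tangent vector has a lift `w'` with `dt(w') = 0`.
  obtain ⟨w', hw', hww'⟩ : ∃ w' : TangentSpace (phaseModel n) p, dt p w' = 0 ∧
      mfderiv (phaseModel n) (𝓡 m) C.proj p w = mfderiv (phaseModel n) (𝓡 m) C.proj p w' := by
    refine ⟨w - dt p w • C.jetLift p, ?_, ?_⟩
    · rw [map_sub, map_smul, dt_jetLift, smul_eq_mul, mul_one, sub_self]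
    · rw [map_sub, map_smul, mfderiv_proj_jetLift hC hproj, smul_zero, sub_zero]
  rw [hww'] at hX ⊢
  rw [eq_zero_of_cartanTwo hL hreg p hw' fun u hu => ?_, map_zero]
  have h4 := C.cartanVert_apply hL hsymm p w' u
  rw [hw', hu, ← hη, pullback_apply_two, ← interiorProduct_apply, hX] at h4
  simpa using h4.symm

theorem mfderiv_comp_proj (hproj : Manifold.IsSubmersion (phaseModel n) (𝓡 m) ∞ C.proj)
    {ℰ : C.Reduced → ℝ} (hℰ : ContMDiff (𝓡 m) 𝓘(ℝ, ℝ) ∞ ℰ) (hℰL : ℰ ∘ C.proj = C.energy L)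
    (p : Phase n Q) (w : TangentSpace (phaseModel n) p) :
    mfderiv (𝓡 m) 𝓘(ℝ, ℝ) ℰ (C.proj p) (mfderiv (phaseModel n) (𝓡 m) C.proj p w) =
      dFun (C.energy L) p w := by
  have h := mfderiv_comp p ((hℰ _).mdifferentiableAt (by simp))
    ((hproj.contMDiff p).mdifferentiableAt (by simp))
  rw [hℰL] at h
  exact (DFunLike.congr_fun h w).symm

/-- The solutions of the Lagrangian dynamics project to Hamiltonian vectors. -/
theorem interiorProduct_mfderiv_proj (hL : ContMDiff (phaseModel n) 𝓘(ℝ, ℝ) ∞ L)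
    (hsymm : C.IsSymmetry L)
    (hproj : Manifold.IsSubmersion (phaseModel n) (𝓡 m) ∞ C.proj) {η : Form (𝓡 m) C.Reduced 2}
    (hη : pullback (phaseModel n) (𝓡 m) C.proj η = C.cartanVert L)
    {ℰ : C.Reduced → ℝ} (hℰ : ContMDiff (𝓡 m) 𝓘(ℝ, ℝ) ∞ ℰ) (hℰL : ℰ ∘ C.proj = C.energy L)
    {p : Phase n Q} {w : TangentSpace (phaseModel n) p}
    (hw : interiorProduct (phaseModel n) w (cartanTwo L p) = 0) (hdt : dt p w = 1) :
    interiorProduct (𝓡 m) (mfderiv (phaseModel n) (𝓡 m) C.proj p w) (η (C.proj p)) =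
      mfderiv (𝓡 m) 𝓘(ℝ, ℝ) ℰ (C.proj p) := by
  have h0 : ∀ u, cartanTwo L p ![w, u] = 0 := fun u => by
    rw [← interiorProduct_apply, hw]
    rfl
  have h1 : dFun (C.energy L) p w = 0 := by
    have h2 := (cartanTwo L p).map_swap ![w, C.jetLift p] (i := 0) (j := 1) (by simp)
    have h3 : ![w, C.jetLift p] ∘ Equiv.swap (0 : Fin 2) 1 = ![C.jetLift p, w] := by
      ext i
      fin_cases i <;> rfl
    rw [h3] at h2
    have h4 : -dFun (C.energy L) p w = -0 := (C.cartanTwo_jetLift hL hsymm p w).symm.trans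
      (h2.trans (congrArg Neg.neg (h0 (C.jetLift p))))
    exact neg_injective h4
  ext v
  obtain ⟨u, rfl⟩ := mfderiv_surjective hproj p v
  rw [interiorProduct_apply, ← pullback_apply_two, hη, C.cartanVert_apply hL hsymm, h0, h1, hdt]
  refine Eq.trans ?_ (mfderiv_comp_proj hproj hℰ hℰL p u).symm
  ring

end Connection

end TimeDependent

end

theorem mainTheorem1 (n : ℕ) (Q : Type*) [TopologicalSpace Q]
    [ChartedSpace (EuclideanSpace ℝ (Fin n)) Q] [IsManifold (𝓡 n) ∞ Q]
    [T2Space Q] [SecondCountableTopology Q] [ConnectedSpace Q]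
    (L : TimeDependent.Phase n Q → ℝ)
    (hL : ContMDiff (TimeDependent.phaseModel n) 𝓘(ℝ, ℝ) ∞ L)
    (hreg : TimeDependent.IsRegular L)
    (C : TimeDependent.Connection n Q)
    (hcomplete : C.IsComplete)
    (hsymm : C.IsSymmetry L)
    (m : ℕ) [ChartedSpace (EuclideanSpace ℝ (Fin m)) C.Reduced] [IsManifold (𝓡 m) ∞ C.Reduced]
    (hproj : Manifold.IsSubmersion (TimeDependent.phaseModel n) (𝓡 m) ∞ C.proj) :
    (∃! η : DiffForm.Form (𝓡 m) C.Reduced 2,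
      DiffForm.pullback (TimeDependent.phaseModel n) (𝓡 m) C.proj η = C.cartanVert L) ∧
    (∃! ℰ : C.Reduced → ℝ, ℰ ∘ C.proj = C.energy L) ∧
    ∀ (η : DiffForm.Form (𝓡 m) C.Reduced 2) (ℰ : C.Reduced → ℝ),
      DiffForm.pullback (TimeDependent.phaseModel n) (𝓡 m) C.proj η = C.cartanVert L →
      ℰ ∘ C.proj = C.energy L →
      DiffForm.IsSymplectic (𝓡 m) η ∧
      ContMDiff (𝓡 m) 𝓘(ℝ, ℝ) ∞ ℰ ∧
      ∃ X : DiffForm.VField (𝓡 m) C.Reduced,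
        ContMDiff (𝓡 m) (𝓡 m).tangent ∞
          (fun x => (⟨x, X x⟩ : TangentBundle (𝓡 m) C.Reduced)) ∧
        (∀ x, DiffForm.interiorProduct (𝓡 m) (X x) (η x) = mfderiv (𝓡 m) 𝓘(ℝ, ℝ) ℰ x) ∧
        (∀ X' : DiffForm.VField (𝓡 m) C.Reduced,
          (∀ x, DiffForm.interiorProduct (𝓡 m) (X' x) (η x) = mfderiv (𝓡 m) 𝓘(ℝ, ℝ) ℰ x) → X' = X) ∧
        ∀ XL : DiffForm.VField (TimeDependent.phaseModel n) (TimeDependent.Phase n Q),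
          (∀ p, DiffForm.interiorProduct (TimeDependent.phaseModel n) (XL p)
            (TimeDependent.cartanTwo L p) = 0) →
          (∀ p, TimeDependent.dt p (XL p) = 1) →
          ∀ p, mfderiv (TimeDependent.phaseModel n) (𝓡 m) C.proj p (XL p) = X (C.proj p) := by
  refine ⟨?_, TimeDependent.Connection.existsUnique_energy hL hsymm, fun η ℰ hη hℰ => ?_⟩
  · obtain ⟨η, _, _, hη⟩ :=
      TimeDependent.Connection.exists_pullback_eq_cartanVert hL hcomplete hsymm hproj
    exact ⟨η, hη, fun η' hη' =>
      DiffForm.pullback_injective hproj Quot.mk_surjective (hη'.trans hη.symm)⟩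
  · have hsymp := TimeDependent.Connection.isSymplectic_of_pullback_eq hL hreg hcomplete hsymm
      hproj hη
    have hsm : ContMDiff (𝓡 m) 𝓘(ℝ, ℝ) ∞ ℰ :=
      DiffForm.contMDiff_of_comp_submersion hproj Quot.mk_surjective
        (hℰ ▸ C.contMDiff_energy hL)
    obtain ⟨X, hX, hXη⟩ := hsymp.exists_hamiltonian hsm
    exact ⟨hsymp, hsm, X, hX, fun x => (hXη x _).2 rfl,
      fun X' hX' => funext fun x => (hXη x _).1 (hX' x),
      fun XL hXL hdt p => (hXη _ _).1 (TimeDependent.Connection.interiorProduct_mfderiv_proj hL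
        hsymm hproj hη hsm hℰ (hXL p) (hdt p))⟩
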